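/- **Conventions.** All Boolean functions take values in $\{-1,1\}$ on a cube $\{-1,1\}^S$. $\mathrm{dep}(\varphi)$ is the set of coordinates on which $\varphi$ depends; $\varphi$ is a *dictator* if $|\mathrm{dep}(\varphi)|=1$, in which case $\varphi(x)=\mathrm{sgn}(\varphi)\,x_i$ with $\mathrm{sgn}(\varphi)\in\{-1,1\}$. **Block form.** Let $I,J$ be finite sets, $F_0,f_j\colon\{-1,1\}^{I}\to\{-1,1\}$ and $G_0,g_i\colon\{-1,1\}^{J}\to\{-1,1\}$ ($i\in I$, $j\in J$). Suppose that $j\in\mathrm{dep}(g_i)\iff i\in\mathrm{dep}(f_j)$, and let $Z_0=\{(i,j): j\in \mathrm{dep}(g_i)\}$. Let $Z_0=Z_1\sqcup\dots\sqcup Z_k$ be a partition into nonempty blocks which are pairwise disjoint in rows and in columns, where $\mathrm{rows}(Z_\ell)$, $\mathrm{cols}(Z_\ell)$ are the projections of $Z_\ell$ to $I$ and $J$. Let $\mathrm{rows}_{\ge2}(Z_\ell)$ be the set of $i\in \mathrm{rows}(Z_\ell)$ with $|\mathrm{dep}(g_i)|\ge2$ and $\mathrm{cols}_{\ge2}(Z_\ell)$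 the set of $j\in\mathrm{cols}(Z_\ell)$ with $|\mathrm{dep}(f_j)|\ge2$. Let $\mathrm{dep}_1(f_j)$ and $\mathrm{dep}_2(f_j)$ consist of the $i\in\mathrm{dep}(f_j)$ such that $g_i$ is a dictator, respectively $|\mathrm{dep}(g_i)|\ge2$, and define $\mathrm{dep}_1(g_i),\mathrm{dep}_2(g_i)$ analogously. Let $x^{\mathrm{sgn}}$ be obtained from $x\in\{-1,1\}^I$ by multiplying $x_i$ by $\mathrm{sgn}(g_i)$ for each dictator $g_i$, and $y^{\mathrm{sgn}}$ from $y\in\{-1,1\}^J$ by multiplying $y_j$ by $\mathrm{sgn}(f_j)$ for each dictator $f_j$. The functions have *block form* with respect to the partition if there are a function $h\colon\{-1,1\}^k\to\{-1,1\}$ depending on all of its inputs and functions $f_0^{(\ell)}\colon\{-1,1\}^I\to\{-1,1\}$, $g_0^{(\ell)}\colon\{-1,1\}^J\to\{-1,1\}$ such that $$F_0=h(f_0^{(1)},\dots,f_0^{(k)}),\qquad G_0=h(g_0^{(1)},\dots,g_0^{(k)}),$$ and for each $\ell$ one of the following holds. 1. $Z_\ell=\{(i,j)\}$, $f_j(x)=\mathrm{sgn}(f_j)x_i$,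 $g_i(y)=\mathrm{sgn}(g_i)y_j$, $f_0^{(\ell)}(x)=\mathrm{sgn}(f_j)x_i$, $g_0^{(\ell)}(y)=\mathrm{sgn}(g_i)y_j$. 2. (XOR-like) $|Z_\ell|\ge2$ and there are functions $\varphi_j\colon\{-1,1\}^{\mathrm{dep}_1(f_j)}\to\{-1,1\}$ and $\gamma_i\colon\{-1,1\}^{\mathrm{dep}_1(g_i)}\to\{-1,1\}$ such that for all $j\in\mathrm{cols}(Z_\ell)$ and $i\in\mathrm{rows}(Z_\ell)$ $$f_j(x)=\varphi_j(x|_{\mathrm{dep}_1(f_j)})\prod_{i'\in\mathrm{dep}_2(f_j)}x_{i'},\qquad g_i(y)=\gamma_i(y|_{\mathrm{dep}_1(g_i)})\prod_{j'\in\mathrm{dep}_2(g_i)}y_{j'},$$ $$f_0^{(\ell)}(x)=\prod_{i\in\mathrm{rows}_{\ge2}(Z_\ell)}x_i\prod_{j\in\mathrm{cols}_{\ge2}(Z_\ell)}\varphi_j(x^{\mathrm{sgn}}|_{\mathrm{dep}_1(f_j)}),\qquad g_0^{(\ell)}(y)=\prod_{j\in\mathrm{cols}_{\ge2}(Z_\ell)}y_j\prod_{i\in\mathrm{rows}_{\ge2}(Z_\ell)}\gamma_i(y^{\mathrm{sgn}}|_{\mathrm{dep}_1(g_i)}).$$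 3. (AND/OR-like) $|Z_\ell|\ge2$ and there are signs $B_j,D_i,\kappa_{ij}\in\{-1,1\}$ and functions $\tilde\varphi_j\colon\{-1,1\}^{\mathrm{dep}_1(f_j)}\to\{0,1\}$, $\tilde\gamma_i\colon\{-1,1\}^{\mathrm{dep}_1(g_i)}\to\{0,1\}$ such that for all $j\in\mathrm{cols}_{\ge2}(Z_\ell)$ and $i\in\mathrm{rows}_{\ge2}(Z_\ell)$ $$f_j(x)=\tilde\varphi_j(x|_{\mathrm{dep}_1(f_j)})\cdot2B_j\prod_{i'\in\mathrm{dep}_2(f_j)}\frac{\kappa_{i'j}x_{i'}+1}{2}-B_j,\qquad g_i(y)=\tilde\gamma_i(y|_{\mathrm{dep}_1(g_i)})\cdot2D_i\prod_{j'\in\mathrm{dep}_2(g_i)}\frac{\kappa_{ij'}y_{j'}+1}{2}-D_i,$$ $$f_0^{(\ell)}(x)=2\prod_{i\in\mathrm{rows}_{\ge2}(Z_\ell)}\frac{D_ix_i+1}{2}\prod_{j\in\mathrm{cols}_{\ge2}(Z_\ell)}\tilde\varphi_j(x^{\mathrm{sgn}}|_{\mathrm{dep}_1(f_j)})-1,\qquad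 g_0^{(\ell)}(y)=2\prod_{j\in\mathrm{cols}_{\ge2}(Z_\ell)}\frac{B_jy_j+1}{2}\prod_{i\in\mathrm{rows}_{\ge2}(Z_\ell)}\tilde\gamma_i(y^{\mathrm{sgn}}|_{\mathrm{dep}_1(g_i)})-1.$$ **Theorem.** Let $n,m\ge0$, let $f_0,\dots,f_m\colon\{-1,1\}^n\to\{-1,1\}$ and $g_0,\dots,g_n\colon\{-1,1\}^m\to\{-1,1\}$ be arbitrary Boolean functions, and consider the equation $$f_0\circ(g_1,\dots,g_n)=g_0\circ(f_1,\dots,f_m),\tag{$*$}$$ that is, $f_0(g_1(z_{11},\dots,z_{1m}),\dots,g_n(z_{n1},\dots,z_{nm}))=g_0(f_1(z_{11},\dots,z_{n1}),\dots,f_m(z_{1m},\dots,z_{nm}))$ for all $z\in\{-1,1\}^{n\times m}$. Let $I\subseteq[n]$ be the set of all $i$ such that $g_i$ is non-constant, let $F_0$ be obtained from $f_0$ by fixing the coordinates outside $I$ to the constants $g_i$, let $\tilde I=\mathrm{dep}(F_0)$, and let $\tilde F_0$ be the restriction of $F_0$ to the coordinates in $\tilde I$. Define $J$, $G_0$, $\tilde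 J$, $\tilde G_0$ analogously from $g_0$ and $f_1,\dots,f_m$. (a) If $(*)$ holds, then $\mathrm{dep}(f_j)\subseteq\tilde I$ for all $j\in\tilde J$ and $\mathrm{dep}(g_i)\subseteq\tilde J$ for all $i\in\tilde I$, and the functions $\tilde F_0$, $f_j$ ($j\in\tilde J$), $\tilde G_0$, $g_i$ ($i\in\tilde I$), regarded as functions on $\{-1,1\}^{\tilde I}$ and $\{-1,1\}^{\tilde J}$, have block form with respect to a partition whose blocks are connected (that is, the partition of $Z_0$ into the connected components of the graph in which two distinct cells are adjacent if they share a row or a column). (b) Conversely, if these inclusions hold and these functions have block form with respect to some partition of $Z_0$ into blocks pairwise disjoint in rows and in columns, then $(*)$ holds. (c) The functions $f_j$ for $j\in J\setminus\tilde J$ and $g_i$ for $i\in I\setminus\tilde I$ are completely arbitrary, as are the values of $f_0$ and $g_0$ at points that disagree with the constant $g_i$, respectively the constant $f_j$: if all of these are replaced by arbitrary Boolean functions and values, then $(*)$ holds for the new functions if and only if it holds for the original ones. -/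

import Mathlib

namespace GeneralizedPolymorphism

/-- The Boolean cube `{-1, 1}^ι`; the two units of `ℤ` serve as the two truth values. -/
abbrev Cube (ι : Type*) := ι → ℤˣ

/-- Boolean functions `{-1, 1}^ι → {-1, 1}`. -/
abbrev BoolFun (ι : Type*) := Cube ι → ℤˣ

/-- The real number `1` or `-1` underlying a sign. -/
def toReal (u : ℤˣ) : ℝ := ((u : ℤ) : ℝ)

/-- The equation `f₀ ∘ (g₁, …, gₙ) = g₀ ∘ (f₁, …, fₘ)`: the rows of the matrix `z` are fed to the
functions `g i`, its columns to the functions `f j`. -/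
def IsGenPoly {ι κ : Type*} (f₀ : BoolFun ι) (f : κ → BoolFun ι)
    (g₀ : BoolFun κ) (g : ι → BoolFun κ) : Prop :=
  ∀ z : ι → κ → ℤˣ, f₀ (fun i => g i (z i)) = g₀ (fun j => f j (fun i => z i j))

def IsConst {ι : Type*} (φ : BoolFun ι) : Prop := ∃ c : ℤˣ, ∀ x, φ x = c

open Classical in
/-- The set of coordinates that are relevant for `φ`. -/
noncomputable def dep {ι : Type*} [Fintype ι] (φ : BoolFun ι) : Finset ι :=
  Finset.univ.filter fun i =>
    ∃ x : Cube ι, φ (Function.update x i 1) ≠ φ (Function.update x i (-1))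

/-- A dictator depends on exactly one coordinate. -/
def IsDictator {ι : Type*} [Fintype ι] (φ : BoolFun ι) : Prop := (dep φ).card = 1

/-- The sign of a dictator: a Boolean dictator has the form `φ x = sgn φ * x i`. -/
def sgn {ι : Type*} (φ : BoolFun ι) : ℤˣ := φ (fun _ => 1)

open Classical in
/-- The function obtained from `f₀` by fixing each coordinate `i` whose `g i` is constant to the
value of that constant. It is formally still a function of all coordinates, but ignores the
fixed ones. -/
noncomputable def fixConst {ι κ : Type*} (f₀ : BoolFun ι) (g : ι → BoolFun κ) : BoolFun ι :=
  fun x => f₀ fun i => if IsConst (g i) then g i (fun _ => 1) else x i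

open Classical in
/-- `φ` as a function of the coordinates in `S` only (used when `dep φ ⊆ S`, so that the value
given to the other coordinates is irrelevant). -/
noncomputable def restrict {ι : Type*} (S : Finset ι) (φ : BoolFun ι) : BoolFun S :=
  fun x => φ fun i => if h : i ∈ S then x ⟨i, h⟩ else 1

/-- The set `Ĩ` of the coordinates that remain relevant for `f₀` after those with a constant `g i`
have been fixed. -/
noncomputable def core {ι κ : Type*} [Fintype ι] (f₀ : BoolFun ι) (g : ι → BoolFun κ) : Finset ι :=
  dep (fixConst f₀ g)

/-- The function `F̃₀` on `{-1, 1}^Ĩ`: the constants `g i` are fixed into `f₀`, and the result is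
restricted to its relevant coordinates. -/
noncomputable def reduced {ι κ : Type*} [Fintype ι] (f₀ : BoolFun ι) (g : ι → BoolFun κ) :
    BoolFun (core f₀ g) :=
  restrict (core f₀ g) (fixConst f₀ g)

/-- The functions `f j`, for `j` in `T`, as functions of the coordinates in `S`. -/
noncomputable def subfamily {ι κ : Type*} (S : Finset ι) (T : Finset κ) (f : κ → BoolFun ι) :
    T → BoolFun S :=
  fun j => restrict S (f j)

section Blocks

variable {ι κ : Type*} [Fintype ι] [DecidableEq ι] [Fintype κ] [DecidableEq κ]

open Classical in
/-- The set `Z₀` of all cells `(i, j)` such that `g i` depends on `j`. -/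
noncomputable def cells (g : ι → BoolFun κ) : Finset (ι × κ) :=
  Finset.univ.filter fun p => p.2 ∈ dep (g p.1)

def rows (A : Finset (ι × κ)) : Finset ι := A.image Prod.fst

def cols (A : Finset (ι × κ)) : Finset κ := A.image Prod.snd

/-- Two cells are adjacent if they are distinct and share a row or a column. -/
def cellGraph (ι κ : Type*) : SimpleGraph (ι × κ) where
  Adj p q := p ≠ q ∧ (p.1 = q.1 ∨ p.2 = q.2)
  symm := ⟨fun _ _ h => ⟨h.1.symm, h.2.imp Eq.symm Eq.symm⟩⟩
  loopless := ⟨fun _ h => h.1 rfl⟩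

/-- A partition into blocks which are pairwise disjoint in rows and in columns. -/
def IsBlockPartition {Z : Finset (ι × κ)} (P : Finpartition Z) : Prop :=
  ∀ A ∈ P.parts, ∀ B ∈ P.parts, A ≠ B →
    Disjoint (rows A) (rows B) ∧ Disjoint (cols A) (cols B)

/-- Every block is connected. A block partition with this property is the partition of `Z` into
the connected components of the graph in which cells sharing a row or a column are adjacent. -/
def HasConnectedBlocks {Z : Finset (ι × κ)} (P : Finpartition Z) : Prop :=
  ∀ A ∈ P.parts, ((cellGraph ι κ).induce (A : Set (ι × κ))).Connected

open Classical in
/-- The rows of the block `A` whose function `g i` depends on at least two coordinates. -/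
noncomputable def rowsTwo (g : ι → BoolFun κ) (A : Finset (ι × κ)) : Finset ι :=
  (rows A).filter fun i => 2 ≤ (dep (g i)).card

open Classical in
/-- The columns of the block `A` whose function `f j` depends on at least two coordinates. -/
noncomputable def colsTwo (f : κ → BoolFun ι) (A : Finset (ι × κ)) : Finset κ :=
  (cols A).filter fun j => 2 ≤ (dep (f j)).card

open Classical in
/-- The relevant coordinates `i` of `φ` for which `g i` is a dictator. -/
noncomputable def depOne (φ : BoolFun ι) (g : ι → BoolFun κ) : Finset ι :=
  (dep φ).filter fun i => IsDictator (g i)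

open Classical in
/-- The relevant coordinates `i` of `φ` for which `g i` depends on at least two coordinates. -/
noncomputable def depTwo (φ : BoolFun ι) (g : ι → BoolFun κ) : Finset ι :=
  (dep φ).filter fun i => 2 ≤ (dep (g i)).card

open Classical in
/-- The vector `x^sgn`: the entry `x i` is multiplied by `sgn (g i)` whenever `g i` is a
dictator. -/
noncomputable def signed (g : ι → BoolFun κ) (x : Cube ι) : Cube ι :=
  fun i => if IsDictator (g i) then sgn (g i) * x i else x i

/-- Degenerate block `A = {(i, j)}`; `a` and `b` are the contributions `f₀^(A)` and `g₀^(A)` of the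
block to `f₀` and `g₀`. -/
def IsSingletonBlock (f : κ → BoolFun ι) (g : ι → BoolFun κ) (A : Finset (ι × κ))
    (a : BoolFun ι) (b : BoolFun κ) : Prop :=
  ∃ i j, A = {(i, j)} ∧
    (∀ x, f j x = sgn (f j) * x i) ∧ (∀ y, g i y = sgn (g i) * y j) ∧
    (∀ x, a x = sgn (f j) * x i) ∧ (∀ y, b y = sgn (g i) * y j)

/-- XOR-like block. -/
def IsXorBlock (f : κ → BoolFun ι) (g : ι → BoolFun κ) (A : Finset (ι × κ))
    (a : BoolFun ι) (b : BoolFun κ) : Prop :=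
  1 < A.card ∧
  ∃ (φ : ∀ j, BoolFun (depOne (f j) g)) (γ : ∀ i, BoolFun (depOne (g i) f)),
    (∀ j ∈ cols A, ∀ x, f j x = φ j (fun i => x i) * ∏ i ∈ depTwo (f j) g, x i) ∧
    (∀ i ∈ rows A, ∀ y, g i y = γ i (fun j => y j) * ∏ j ∈ depTwo (g i) f, y j) ∧
    (∀ x, a x = (∏ i ∈ rowsTwo g A, x i) *
      ∏ j ∈ colsTwo f A, φ j (fun i => signed g x i)) ∧
    (∀ y, b y = (∏ j ∈ colsTwo f A, y j) *
      ∏ i ∈ rowsTwo g A, γ i (fun j => signed f y j))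

/-- AND/OR-like block; the signs `c i j` are shared by `f j` and `g i`. -/
def IsAndOrBlock (f : κ → BoolFun ι) (g : ι → BoolFun κ) (A : Finset (ι × κ))
    (a : BoolFun ι) (b : BoolFun κ) : Prop :=
  1 < A.card ∧
  ∃ (B : κ → ℤˣ) (D : ι → ℤˣ) (c : ι → κ → ℤˣ)
    (φ : ∀ j, Cube (depOne (f j) g) → ℝ) (γ : ∀ i, Cube (depOne (g i) f) → ℝ),
    (∀ j u, φ j u = 0 ∨ φ j u = 1) ∧ (∀ i v, γ i v = 0 ∨ γ i v = 1) ∧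
    (∀ j ∈ colsTwo f A, ∀ x, toReal (f j x) =
      φ j (fun i => x i) * (2 * toReal (B j)) *
        (∏ i ∈ depTwo (f j) g, (toReal (c i j) * toReal (x i) + 1) / 2) - toReal (B j)) ∧
    (∀ i ∈ rowsTwo g A, ∀ y, toReal (g i y) =
      γ i (fun j => y j) * (2 * toReal (D i)) *
        (∏ j ∈ depTwo (g i) f, (toReal (c i j) * toReal (y j) + 1) / 2) - toReal (D i)) ∧
    (∀ x, toReal (a x) =
      2 * (∏ i ∈ rowsTwo g A, (toReal (D i) * toReal (x i) + 1) / 2) *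
        (∏ j ∈ colsTwo f A, φ j (fun i => signed g x i)) - 1) ∧
    (∀ y, toReal (b y) =
      2 * (∏ j ∈ colsTwo f A, (toReal (B j) * toReal (y j) + 1) / 2) *
        (∏ i ∈ rowsTwo g A, γ i (fun j => signed f y j)) - 1)

/-- The block form with respect to a partition `P` of the set `Z₀` of relevant cells: `f₀` and
`g₀` are obtained from one function `h`, all of whose inputs are relevant, by plugging in the
contributions of the blocks. -/
def HasBlockForm (f₀ : BoolFun ι) (f : κ → BoolFun ι) (g₀ : BoolFun κ) (g : ι → BoolFun κ)
    (P : Finpartition (cells g)) : Prop :=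
  (∀ i j, j ∈ dep (g i) ↔ i ∈ dep (f j)) ∧
  ∃ (h : BoolFun P.parts) (a : P.parts → BoolFun ι) (b : P.parts → BoolFun κ),
    dep h = Finset.univ ∧
    (∀ x, f₀ x = h (fun A => a A x)) ∧
    (∀ y, g₀ y = h (fun A => b A y)) ∧
    ∀ A : P.parts,
      IsSingletonBlock f g A (a A) (b A) ∨
      IsXorBlock f g A (a A) (b A) ∨
      IsAndOrBlock f g A (a A) (b A)

end Blocks

end GeneralizedPolymorphism

open GeneralizedPolymorphism

/-!
Both sides of the equation `F ∘ (g₁, …, gₙ) = G ∘ (f₁, …, fₘ)` are one function `H` of the matrix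
`z`. After the constants have been fixed and irrelevant coordinates dropped, all inner functions
are onto, so `H` depends on the cell `(i, j)` exactly if `F` depends on `i` and `g i` on `j`, and
exactly if `G` depends on `j` and `f j` on `i` (`IsGenPoly.mem_dep`). This gives the inclusions
between the supports and the symmetry of the set of relevant cells.

*One component.* Fixing all cells outside a connected component `A` turns the equation into one
between outer functions `P`, `Q` that only see the rows and columns of `A`. Call a cell of `A` a
core cell if its row and its column both contain a second cell. At a core cell, `g i` and `f j`
share one variable, and comparing how `H` reacts to it shows that either both functions are
flipped by this variable, or both are forced by the same value of it (`xorAt_or_andAt`). The core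
cells are connected, so the type is the same for all of them. The outer functions are then
determined up to a common sign. The main tool is `IsComponent.exists_const`: if each core cell
`(i, j)` gives rise to an equation with the same inner functions and outer functions `p i` and
`q j` that ignore `i` and `j`, then all of these outer functions are one and the same constant.
It is applied to the products `P (x with x i flipped) * P x` in the XOR-like case, where it shows
that `P` is a parity in the rows with several cells (`IsComponent.exists_eq_mul_xorPart`), and to
`P (x with x i set to its forced value)` in the AND/OR-like case, where it shows that `P` is a
conjunction (`IsComponent.exists_eq_mul_andPart`).

*All components.* By the uniqueness up to sign, `F` depends on the rows of `A` only through the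
contribution `a` of `A` (`IsComponent.exists_contribution`), whatever the other coordinates are.
Hence `F = h (a₁, …, aₖ)` with `h` read off at representatives of the values of the `aₗ`, and
`G = h (b₁, …, bₖ)` follows because `aₗ (g z) = bₗ (f z)` for each block. These block identities,
which are computations with finite products over the core cells, also yield the converse.
-/

namespace GeneralizedPolymorphism

open Function

set_option linter.unusedSectionVars false

/-! ### Relevant coordinates -/

theorem units_eq_neg_of_ne {s t : ℤˣ} (h : s ≠ t) : s = -t := by
  rcases Int.units_eq_one_or s with rfl | rfl <;> rcases Int.units_eq_one_or t with rfl | rfl <;>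
    simp_all

theorem units_ne_neg (s : ℤˣ) : s ≠ -s := by
  rcases Int.units_eq_one_or s with rfl | rfl <;> decide

theorem toReal_injective : Injective toReal := fun s t h => by
  unfold toReal at h
  exact Units.ext (by exact_mod_cast h)

@[simp] theorem toReal_one : toReal 1 = 1 := by simp [toReal]

@[simp] theorem toReal_neg (s : ℤˣ) : toReal (-s) = -toReal s := by simp [toReal]

/-- The real factor `(s t + 1) / 2` is the indicator of `t = s`. -/
theorem indicator_eq (s t : ℤˣ) :
    (toReal s * toReal t + 1) / 2 = if t = s then 1 else 0 := by
  rcases Int.units_eq_one_or s with rfl | rfl <;> rcases Int.units_eq_one_or t with rfl | rfl <;>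
    norm_num [units_ne_neg, (units_ne_neg _).symm]

section Dep

variable {ι κ : Type*} [Fintype ι] [DecidableEq ι]

theorem mem_dep {φ : BoolFun ι} {i : ι} :
    i ∈ dep φ ↔ ∃ x : Cube ι, φ (update x i 1) ≠ φ (update x i (-1)) := by
  classical
  simp only [dep, Finset.mem_filter, Finset.mem_univ, true_and]
  refine exists_congr fun x => ?_
  have h : ∀ c : ℤˣ, @update ι (fun _ => ℤˣ) (fun a b => Classical.propDecidable (a = b)) x i c
      = update x i c := by
    intro c; congr; exact Subsingleton.elim _ _
  rw [h, h]

theorem not_mem_dep {φ : BoolFun ι} {i : ι} :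
    i ∉ dep φ ↔ ∀ (x : Cube ι) c, φ (update x i c) = φ x := by
  rw [mem_dep]
  push Not
  constructor
  · intro h x c
    have h2 : φ x = φ (update x i (x i)) := by rw [update_eq_self]
    rw [h2]
    rcases Int.units_eq_one_or c with rfl | rfl <;>
      rcases Int.units_eq_one_or (x i) with h' | h' <;> rw [h'] <;> simp [h x]
  · intro h x; rw [h, h]

/-- A Boolean function sees its argument through its relevant coordinates only. -/
theorem eq_of_eqOn_dep (φ : BoolFun ι) {x y : Cube ι} (h : ∀ i ∈ dep φ, x i = y i) :
    φ x = φ y := by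
  suffices H : ∀ S : Finset ι, ∀ x y : Cube ι, (∀ i ∈ dep φ, x i = y i) →
      (∀ i ∉ S, x i = y i) → φ x = φ y from
    H Finset.univ x y h (by simp)
  intro S
  induction S using Finset.induction_on with
  | empty => intro x y _ h2; rw [show x = y from funext fun i => h2 i (by simp)]
  | insert a S ha ih =>
    intro x y h1 h2
    have key : φ (update x a (y a)) = φ y := by
      refine ih _ _ (fun i hi => ?_) (fun i hi => ?_)
      · by_cases hia : i = a
        · subst hia; simp
        · simp [hia, h1 i hi]
      · by_cases hia : i = a
        · subst hia; simp
        · simp [hia, h2 i (by simp [hia, hi])]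
    rw [← key]
    by_cases had : a ∈ dep φ
    · rw [← h1 a had, update_eq_self]
    · rw [not_mem_dep.1 had]

theorem isConst_of_dep_eq_empty {φ : BoolFun ι} (h : dep φ = ∅) : IsConst φ :=
  ⟨φ 1, fun x => eq_of_eqOn_dep φ (by simp [h])⟩

theorem not_isConst_of_mem_dep {φ : BoolFun ι} {i : ι} (h : i ∈ dep φ) : ¬ IsConst φ := by
  rintro ⟨c, hc⟩
  obtain ⟨x, hx⟩ := mem_dep.1 h
  exact hx (by rw [hc, hc])

theorem dep_nonempty {φ : BoolFun ι} (h : ¬ IsConst φ) : (dep φ).Nonempty := by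
  rw [Finset.nonempty_iff_ne_empty]
  exact fun h' => h (isConst_of_dep_eq_empty h')

omit [Fintype ι] [DecidableEq ι] in
theorem exists_eq_of_not_isConst {φ : BoolFun ι} (h : ¬ IsConst φ) (c : ℤˣ) : ∃ x, φ x = c := by
  by_contra h'
  push Not at h'
  exact h ⟨-c, fun x => units_eq_neg_of_ne (h' x)⟩

theorem dep_subset_of_forall {φ : BoolFun ι} {S : Finset ι}
    (h : ∀ x y : Cube ι, (∀ i ∈ S, x i = y i) → φ x = φ y) : dep φ ⊆ S := by
  intro i hi
  by_contra hS
  refine (not_mem_dep.2 fun x c => ?_) hi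
  exact h _ _ fun k hk => update_of_ne (by rintro rfl; exact hS hk) _ _

/-- A dictator is its sign times its only relevant coordinate. -/
theorem dictator_apply {φ : BoolFun ι} {i : ι} (h : IsDictator φ) (hi : i ∈ dep φ) (x : Cube ι) :
    φ x = sgn φ * x i := by
  obtain ⟨k, hk⟩ := Finset.card_eq_one.1 h
  have hki : i = k := by simpa [hk] using hi
  subst hki
  obtain ⟨u, hu⟩ := mem_dep.1 hi
  have e : ∀ (v w : Cube ι), v i = w i → φ v = φ w := fun v w hvw =>
    eq_of_eqOn_dep φ (by simpa [hk] using hvw)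
  have e1 : sgn φ = φ (update u i 1) := e _ _ (by simp)
  rcases Int.units_eq_one_or (x i) with h1 | h1
  · rw [h1, e1, e x (update u i 1) (by simp [h1])]; simp
  · rw [h1, e1, e x (update u i (-1)) (by simp [h1])]
    simpa using units_eq_neg_of_ne hu.symm

omit [Fintype ι] [DecidableEq ι] in
theorem exists_apply_eq {g : ι → BoolFun κ} (S : Finset ι) (hg : ∀ i ∈ S, ¬ IsConst (g i))
    (x : Cube ι) : ∃ z : ι → κ → ℤˣ, ∀ i ∈ S, g i (z i) = x i := by
  have h : ∀ i, ∃ y, i ∈ S → g i y = x i := fun i => by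
    by_cases hi : i ∈ S
    · obtain ⟨y, hy⟩ := exists_eq_of_not_isConst (hg i hi) (x i)
      exact ⟨y, fun _ => hy⟩
    · exact ⟨1, fun h => absurd h hi⟩
  choose z hz using h
  exact ⟨z, hz⟩

theorem exists_apply_eq' {g : ι → BoolFun κ} (hg : ∀ i, ¬ IsConst (g i))
    (x : Cube ι) : ∃ z : ι → κ → ℤˣ, (fun i => g i (z i)) = x := by
  obtain ⟨z, hz⟩ := exists_apply_eq Finset.univ (fun i _ => hg i) x
  exact ⟨z, funext fun i => hz i (by simp)⟩

end Dep

section GenPoly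

variable {ι κ : Type*}

theorem IsGenPoly.symm {P : BoolFun ι} {f : κ → BoolFun ι} {Q : BoolFun κ} {g : ι → BoolFun κ}
    (h : IsGenPoly P f Q g) : IsGenPoly Q g P f :=
  fun z => (h fun i j => z j i).symm

variable [Fintype ι] [DecidableEq ι] [Fintype κ] [DecidableEq κ]

/-- If `P` depends on `i` and `g i` depends on `j`, then the common composition depends on the
cell `(i, j)`, so that `Q` depends on `j` and `f j` depends on `i`. -/
theorem IsGenPoly.mem_dep {P : BoolFun ι} {f : κ → BoolFun ι} {Q : BoolFun κ} {g : ι → BoolFun κ}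
    (h : IsGenPoly P f Q g) (hg : ∀ i ∈ dep P, ¬ IsConst (g i)) {i : ι} {j : κ}
    (hi : i ∈ dep P) (hj : j ∈ dep (g i)) : j ∈ dep Q ∧ i ∈ dep (f j) := by
  obtain ⟨x, hx⟩ := GeneralizedPolymorphism.mem_dep.1 hi
  obtain ⟨z, hz⟩ := exists_apply_eq _ hg x
  obtain ⟨y, hy⟩ := GeneralizedPolymorphism.mem_dep.1 hj
  have hP : ∀ c, P (fun i' => g i' (update z i (update y j c) i'))
      = P (update x i (g i (update y j c))) := fun c => by
    refine eq_of_eqOn_dep P fun k hk => ?_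
    by_cases hki : k = i
    · subst hki; simp
    · simp [hki, hz k hk]
  have hne : P (update x i (g i (update y j 1))) ≠ P (update x i (g i (update y j (-1)))) := by
    rcases Int.units_eq_one_or (g i (update y j 1)) with h1 | h1 <;>
    rcases Int.units_eq_one_or (g i (update y j (-1))) with h2 | h2 <;>
      simp_all [hx.symm]
  rw [← hP, ← hP, h, h] at hne
  have hother : ∀ j', j' ≠ j → ∀ i', update z i (update y j 1) i' j' =
      update z i (update y j (-1)) i' j' := fun j' hj' i' => by
    by_cases hki : i' = i
    · subst hki; simp [hj']
    · simp [hki]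
  constructor
  · by_contra hQ
    refine hne (eq_of_eqOn_dep Q fun j' hj' => ?_)
    have : j' ≠ j := by rintro rfl; exact hQ hj'
    simp only [hother j' this]
  · by_contra hf
    refine hne (congrArg Q (funext fun j' => ?_))
    by_cases hjj : j' = j
    · subst hjj
      refine eq_of_eqOn_dep _ fun k hk => ?_
      have : k ≠ i := by rintro rfl; exact hf hk
      simp [this]
    · simp only [hother j' hjj]

/-- The relation `i ∈ dep P` propagates along the cells. -/
theorem IsGenPoly.mem_dep_iff {P : BoolFun ι} {f : κ → BoolFun ι} {Q : BoolFun κ}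
    {g : ι → BoolFun κ} (h : IsGenPoly P f Q g) (hf : ∀ j, ¬ IsConst (f j))
    (hg : ∀ i, ¬ IsConst (g i)) (hcomp : ∀ i j, j ∈ dep (g i) ↔ i ∈ dep (f j)) {i : ι} {j : κ}
    (hj : j ∈ dep (g i)) : i ∈ dep P ↔ j ∈ dep Q :=
  ⟨fun hi => (h.mem_dep (fun i _ => hg i) hi hj).1,
    fun hj' => (h.symm.mem_dep (fun j _ => hf j) hj' ((hcomp i j).1 hj)).1⟩

end GenPoly

/-! ### The type of a cell -/

/-- Changing the coordinate `i` always changes the value of `φ`. -/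
def XorAt {ι : Type*} [DecidableEq ι] (φ : BoolFun ι) (i : ι) : Prop :=
  ∀ x, φ (update x i (-x i)) = -φ x

/-- Setting the coordinate `i` to `c` forces the value of `φ`. -/
def AndAt {ι : Type*} (φ : BoolFun ι) (i : ι) (c : ℤˣ) : Prop :=
  ∃ d, ∀ x, x i = c → φ x = d

/-- Two functions `u` and `v` that share one variable, each followed by an outer function that may
also depend on the remaining variables of the other one. If both depend on their other variables
as well, then both are of the same type at the shared variable. -/
theorem xorAt_or_andAt {ι κ : Type*} [DecidableEq ι] [DecidableEq κ] {i : ι} {j : κ}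
    {u : BoolFun κ} {v : BoolFun ι} {p : Cube ι → ℤˣ → ℤˣ} {q : Cube κ → ℤˣ → ℤˣ}
    (heq : ∀ a b c, p b (u (update a j c)) = q a (v (update b i c)))
    {b₀ : Cube ι} (hp : p b₀ 1 ≠ p b₀ (-1))
    {a₁ : Cube κ} (ha₁ : u (update a₁ j 1) ≠ u (update a₁ j (-1)))
    (hu : ∃ a a' : Cube κ, a j = a' j ∧ u a ≠ u a')
    (hv : ∃ b b' : Cube ι, b i = b' i ∧ v b ≠ v b') :
    (XorAt u j ∧ XorAt v i) ∨ ∃ c, AndAt u j c ∧ AndAt v i c := by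
  have ha₁' : ∀ c, u (update a₁ j (-c)) = - u (update a₁ j c) := fun c => by
    rcases Int.units_eq_one_or c with rfl | rfl
    · exact units_eq_neg_of_ne ha₁.symm
    · simpa using units_eq_neg_of_ne ha₁
  have hp' : ∀ s t, p b₀ s = p b₀ t → s = t := fun s t h => by
    rcases Int.units_eq_one_or s with rfl | rfl <;>
      rcases Int.units_eq_one_or t with rfl | rfl <;> simp_all
  have hb₀ : ∀ c, v (update b₀ i (-c)) = - v (update b₀ i c) := fun c => by
    refine units_eq_neg_of_ne fun h => ?_
    have := heq a₁ b₀ (-c)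
    rw [h, ← heq, ha₁'] at this
    exact units_ne_neg _ (hp' _ _ this).symm
  -- Where `v` ignores the shared variable, `u` is forced by one of its values.
  have hconst : ∀ b c₀, (∀ c, v (update b i c) = v (update b₀ i c₀)) → AndAt u j c₀ := by
    intro b c₀ hb
    have h1 : ∀ a c, p b (u (update a j c)) = p b₀ (u (update a j c₀)) := fun a c => by
      rw [heq, hb, ← heq]
    have h2 : ∀ s t, p b s = p b t := fun s t => by
      have h3 := (h1 a₁ 1).trans (h1 a₁ (-1)).symm
      rw [ha₁'] at h3
      rcases eq_or_ne s t with h | h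
      · rw [h]
      · rw [units_eq_neg_of_ne h]
        rcases eq_or_ne t (u (update a₁ j 1)) with h' | h'
        · rw [h', h3]
        · rw [units_eq_neg_of_ne h', neg_neg, h3]
    refine ⟨u (update 1 j c₀), fun x hx => ?_⟩
    rw [← update_eq_self j x, hx]
    refine hp' _ _ ?_
    rw [← h1 x c₀, ← h1 1 c₀]
    exact h2 _ _
  -- Where the sign of the shared variable in `v` is reversed, `u` is of XOR type.
  have hflip : ∀ b, (∀ c, v (update b i c) = v (update b₀ i (-c))) → XorAt u j := by
    intro b hb
    have h1 : ∀ a c, p b (u (update a j c)) = p b₀ (u (update a j (-c))) := fun a c => by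
      rw [heq, hb, ← heq]
    have h2 : ∀ s, p b s = p b₀ (-s) := fun s => by
      rcases eq_or_ne s (u (update a₁ j 1)) with h' | h'
      · rw [h', h1, ha₁']
      · rw [units_eq_neg_of_ne h', ← ha₁' 1, h1, ha₁' (-1)]
    intro x
    have h3 := h1 x (x j)
    rw [h2, update_eq_self] at h3
    exact (hp' _ _ h3).symm
  have hexcl : ∀ c, XorAt u j → AndAt u j c → False := by
    rintro c hX ⟨d, hd⟩
    obtain ⟨a, a', haa, hne⟩ := hu
    apply hne
    by_cases hc : a j = c
    · rw [hd a hc, hd a' (haa ▸ hc)]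
    · have hc' := units_eq_neg_of_ne hc
      have h1 := hX a
      have h2 := hX a'
      rw [hd _ (by simp [hc'])] at h1
      rw [hd _ (by simp [← haa, hc'])] at h2
      exact neg_injective (h1.symm.trans h2)
  have hexcl2 : ∀ c, AndAt u j c → AndAt u j (-c) → False := by
    rintro c ⟨d, hd⟩ ⟨d', hd'⟩
    obtain ⟨a, a', haa, hne⟩ := hu
    apply hne
    by_cases hc : a j = c
    · rw [hd a hc, hd a' (haa ▸ hc)]
    · have hc' := units_eq_neg_of_ne hc
      rw [hd' a hc', hd' a' (haa ▸ hc')]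
  have hcases : ∀ b, (∃ c₀, ∀ c, v (update b i c) = v (update b₀ i c₀)) ∨
      (∀ c, v (update b i c) = v (update b₀ i (-c))) ∨
      (∀ c, v (update b i c) = v (update b₀ i c)) := by
    intro b
    have hb' := hb₀ 1
    have key : ∀ s t r : ℤˣ, (s = r ∧ t = r) ∨ (s = -r ∧ t = -r) ∨ (s = -r ∧ t = r) ∨
        (s = r ∧ t = -r) := by decide
    have all : ∀ (P : ℤˣ → Prop), P 1 → P (-1) → ∀ c, P c := fun P h1 h2 c => by
      rcases Int.units_eq_one_or c with rfl | rfl <;> assumption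
    rcases key (v (update b i 1)) (v (update b i (-1))) (v (update b₀ i 1)) with h | h | h | h
    · exact Or.inl ⟨1, all _ h.1 h.2⟩
    · exact Or.inl ⟨-1, all _ (by rw [h.1, hb']) (by rw [h.2, hb'])⟩
    · exact Or.inr (Or.inl (all _ (by rw [h.1, hb']) (by rw [h.2, neg_neg])))
    · exact Or.inr (Or.inr (all _ (by rw [h.1]) (by rw [h.2, hb'])))
  by_cases hX : XorAt u j
  · refine Or.inl ⟨hX, fun b => ?_⟩
    have self : v b = v (update b i (b i)) := by rw [update_eq_self]
    rcases hcases b with ⟨c₀, h⟩ | h | h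
    · exact (hexcl _ hX (hconst b c₀ h)).elim
    · rw [self, h, h, hb₀ (-b i)]
    · rw [self, h, h, hb₀]
  · -- Since `v` depends on other variables too, it ignores the shared one somewhere.
    have hex : ∃ b c₀, ∀ c, v (update b i c) = v (update b₀ i c₀) := by
      by_contra hno
      push Not at hno
      obtain ⟨b, b', hbb, hne⟩ := hv
      have h1 : ∀ b c, v (update b i c) = v (update b₀ i c) := fun b => by
        rcases hcases b with ⟨c₀, h⟩ | h | h
        · obtain ⟨c, hc⟩ := hno b c₀
          exact absurd (h c) hc
        · exact absurd (hflip b h) hX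
        · exact h
      apply hne
      rw [← update_eq_self i b, ← update_eq_self i b', h1 b, h1 b', hbb]
    obtain ⟨b, c₀, hb⟩ := hex
    refine Or.inr ⟨c₀, hconst b c₀ hb, v (update b₀ i c₀), fun x hx => ?_⟩
    have self : v x = v (update x i (x i)) := by rw [update_eq_self]
    rcases hcases x with ⟨c₁, h⟩ | h | h
    · rcases eq_or_ne c₁ c₀ with rfl | hne
      · rw [self, h]
      · rw [units_eq_neg_of_ne hne] at h
        exact (hexcl2 _ (hconst b c₀ hb) (hconst x _ h)).elim
    · exact absurd (hflip x h) hX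
    · rw [self, h, hx]

/-- A cell whose row function and column function both depend on at least two coordinates. -/
def IsCore {ι κ : Type*} [Fintype ι] [Fintype κ] (f : κ → BoolFun ι) (g : ι → BoolFun κ)
    (i : ι) (j : κ) : Prop :=
  j ∈ dep (g i) ∧ 2 ≤ (dep (g i)).card ∧ 2 ≤ (dep (f j)).card

section Cell

variable {ι κ : Type*} [Fintype ι] [DecidableEq ι] [Fintype κ] [DecidableEq κ]

theorem exists_eq_and_ne {φ : BoolFun ι} (h : 2 ≤ (dep φ).card) (i : ι) :
    ∃ x y : Cube ι, x i = y i ∧ φ x ≠ φ y := by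
  obtain ⟨k, hk, hki⟩ := Finset.exists_mem_ne h i
  obtain ⟨x, hx⟩ := mem_dep.1 hk
  exact ⟨_, _, by simp [hki.symm], hx⟩

theorem IsGenPoly.xorAt_or_andAt {P : BoolFun ι} {f : κ → BoolFun ι} {Q : BoolFun κ}
    {g : ι → BoolFun κ} (h : IsGenPoly P f Q g) (hg : ∀ i, ¬ IsConst (g i)) {i : ι} {j : κ}
    (hc : IsCore f g i j) (hi : i ∈ dep P) :
    (XorAt (g i) j ∧ XorAt (f j) i) ∨ ∃ c, AndAt (g i) j c ∧ AndAt (f j) i c := by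
  obtain ⟨x, hx⟩ := GeneralizedPolymorphism.mem_dep.1 hi
  obtain ⟨z, hz⟩ := exists_apply_eq' hg x
  obtain ⟨a₁, ha₁⟩ := GeneralizedPolymorphism.mem_dep.1 hc.1
  refine GeneralizedPolymorphism.xorAt_or_andAt
    (p := fun b s => P (update (fun i' => g i' (update (z i') j (b i'))) i s))
    (q := fun a t => Q (update (fun j' => f j' (update (fun i' => z i' j') i (a j'))) j t))
    (b₀ := fun i' => z i' j) (fun a b c => ?_) ?_ ha₁ (exists_eq_and_ne hc.2.1 j)
    (exists_eq_and_ne hc.2.2 i)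
  · -- The matrix `z` with its row `i` replaced by `a`, its column `j` by `b`, and the cell by `c`.
    let w : ι → κ → ℤˣ := update (fun i' => update (z i') j (b i')) i (update a j c)
    have h1 := h w
    have e1 : (fun i' => g i' (w i')) =
        update (fun i' => g i' (update (z i') j (b i'))) i (g i (update a j c)) := by
      funext i'
      by_cases hi' : i' = i
      · subst hi'; simp [w]
      · simp [w, hi']
    have e2 : (fun j' => f j' (fun i' => w i' j')) =
        update (fun j' => f j' (update (fun i' => z i' j') i (a j'))) j (f j (update b i c)) := by
      funext j'
      by_cases hj' : j' = j
      · subst hj'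
        simp only [update_self]
        congr 1
        funext i'
        by_cases hi' : i' = i
        · subst hi'; simp [w]
        · simp [w, hi']
      · simp only [update_of_ne hj']
        congr 1
        funext i'
        by_cases hi' : i' = i
        · subst hi'; simp [w, hj']
        · simp [w, hi', hj']
    rw [e1, e2] at h1
    exact h1
  · simpa [hz] using hx

end Cell

/-! ### Connected components of the set of cells -/

section Component

variable {ι κ : Type*} [Fintype ι] [DecidableEq ι] [Fintype κ] [DecidableEq κ]

/-- The standing assumptions on the inner functions of a reduced equation: none is constant, and
both families give rise to the same set of cells. -/
structure IsCompatible (f : κ → BoolFun ι) (g : ι → BoolFun κ) : Prop where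
  left : ∀ j, ¬ IsConst (f j)
  right : ∀ i, ¬ IsConst (g i)
  mem_iff : ∀ i j, j ∈ dep (g i) ↔ i ∈ dep (f j)

/-- `A` is a connected component of the set of cells. Connectedness is encoded as an induction
principle: a property that passes between cells in a common line holds everywhere or nowhere. -/
structure IsComponent (g : ι → BoolFun κ) (A : Finset (ι × κ)) : Prop where
  nonempty : A.Nonempty
  mem_dep : ∀ {i j}, (i, j) ∈ A → j ∈ dep (g i)
  row_closed : ∀ {i j j'}, (i, j) ∈ A → j' ∈ dep (g i) → (i, j') ∈ A
  col_closed : ∀ {i i' j}, (i, j) ∈ A → j ∈ dep (g i') → (i', j) ∈ A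
  induction : ∀ T : ι → κ → Prop,
    (∀ i j j', (i, j) ∈ A → (i, j') ∈ A → T i j → T i j') →
    (∀ i i' j, (i, j) ∈ A → (i', j) ∈ A → T i j → T i' j) →
    ∀ {i j i' j'}, (i, j) ∈ A → (i', j') ∈ A → T i j → T i' j'

/-- The cells of `A` with rows and columns exchanged. -/
def transpose (A : Finset (ι × κ)) : Finset (κ × ι) := A.image Prod.swap

@[simp] theorem mem_transpose {A : Finset (ι × κ)} {i : ι} {j : κ} :
    (j, i) ∈ transpose A ↔ (i, j) ∈ A := by
  simp [transpose]

theorem mem_rows {A : Finset (ι × κ)} {i : ι} : i ∈ rows A ↔ ∃ j, (i, j) ∈ A := by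
  simp [rows]

theorem mem_cols {A : Finset (ι × κ)} {j : κ} : j ∈ cols A ↔ ∃ i, (i, j) ∈ A := by
  simp [cols]

@[simp] theorem rows_transpose (A : Finset (ι × κ)) : rows (transpose A) = cols A := by
  ext; simp [mem_rows, mem_cols]

@[simp] theorem cols_transpose (A : Finset (ι × κ)) : cols (transpose A) = rows A := by
  ext; simp [mem_rows, mem_cols]

theorem mem_rowsTwo {g : ι → BoolFun κ} {A : Finset (ι × κ)} {i : ι} :
    i ∈ rowsTwo g A ↔ i ∈ rows A ∧ 2 ≤ (dep (g i)).card := by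
  simp [rowsTwo]

theorem mem_colsTwo {f : κ → BoolFun ι} {A : Finset (ι × κ)} {j : κ} :
    j ∈ colsTwo f A ↔ j ∈ cols A ∧ 2 ≤ (dep (f j)).card := by
  simp [colsTwo]

theorem rowsTwo_transpose (f : κ → BoolFun ι) (A : Finset (ι × κ)) :
    rowsTwo f (transpose A) = colsTwo f A := by
  ext; simp [mem_rowsTwo, mem_colsTwo]

theorem colsTwo_transpose (g : ι → BoolFun κ) (A : Finset (ι × κ)) :
    colsTwo g (transpose A) = rowsTwo g A := by
  ext; simp [mem_rowsTwo, mem_colsTwo]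

variable {f : κ → BoolFun ι} {g : ι → BoolFun κ} {A : Finset (ι × κ)}
  {P : BoolFun ι} {Q : BoolFun κ}

theorem IsCompatible.symm (h : IsCompatible f g) : IsCompatible g f :=
  ⟨h.right, h.left, fun j i => (h.mem_iff i j).symm⟩

theorem IsCore.symm (hfg : IsCompatible f g) {i : ι} {j : κ} (h : IsCore f g i j) :
    IsCore g f j i :=
  ⟨(hfg.mem_iff i j).1 h.1, h.2.2, h.2.1⟩

theorem IsComponent.symm (hfg : IsCompatible f g) (hA : IsComponent g A) :
    IsComponent f (transpose A) where
  nonempty := hA.nonempty.image _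
  mem_dep h := (hfg.mem_iff _ _).1 (hA.mem_dep (mem_transpose.1 h))
  row_closed h h' := mem_transpose.2 (hA.col_closed (mem_transpose.1 h) ((hfg.mem_iff _ _).2 h'))
  col_closed h h' := mem_transpose.2 (hA.row_closed (mem_transpose.1 h) ((hfg.mem_iff _ _).2 h'))
  induction T hrow hcol _ _ _ _ h h' :=
    hA.induction (fun i j => T j i)
      (fun i j j' h1 h2 => hcol j j' i (mem_transpose.2 h1) (mem_transpose.2 h2))
      (fun i i' j h1 h2 => hrow j i i' (mem_transpose.2 h1) (mem_transpose.2 h2))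
      (mem_transpose.1 h) (mem_transpose.1 h')

theorem IsComponent.mem_of_mem_rows (hA : IsComponent g A) {i : ι} {j : κ} (hi : i ∈ rows A)
    (hj : j ∈ dep (g i)) : (i, j) ∈ A := by
  obtain ⟨j', h⟩ := mem_rows.1 hi
  exact hA.row_closed h hj

theorem IsComponent.mem_of_mem_cols (hfg : IsCompatible f g) (hA : IsComponent g A) {i : ι} {j : κ}
    (hj : j ∈ cols A) (hi : i ∈ dep (f j)) : (i, j) ∈ A := by
  obtain ⟨i', h⟩ := mem_cols.1 hj
  exact hA.col_closed h ((hfg.mem_iff _ _).2 hi)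

theorem IsComponent.dep_subset_cols (hfg : IsCompatible f g) (hA : IsComponent g A)
    (h : IsGenPoly P f Q g) (hP : dep P ⊆ rows A) : dep Q ⊆ cols A := by
  intro j hj
  obtain ⟨i, hi⟩ := dep_nonempty (hfg.left j)
  have hj' := (hfg.mem_iff i j).2 hi
  have := (h.mem_dep_iff hfg.left hfg.right hfg.mem_iff hj').2 hj
  exact mem_cols.2 ⟨i, hA.mem_of_mem_rows (hP this) hj'⟩

/-- By connectedness, a non-constant outer function of a component depends on all of its rows. -/
theorem IsComponent.rows_subset_dep (hfg : IsCompatible f g) (hA : IsComponent g A)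
    (h : IsGenPoly P f Q g) (hP : dep P ⊆ rows A) (hne : ¬ IsConst P) : rows A ⊆ dep P := by
  intro i hi
  obtain ⟨j, hij⟩ := mem_rows.1 hi
  obtain ⟨i₀, hi₀⟩ := dep_nonempty hne
  obtain ⟨j₀, hij₀⟩ := mem_rows.1 (hP hi₀)
  refine hA.induction (fun i _ => i ∈ dep P) (fun _ _ _ _ _ h => h) (fun i i' j h1 h2 h3 => ?_)
    hij₀ hij hi₀
  rw [h.mem_dep_iff hfg.left hfg.right hfg.mem_iff (hA.mem_dep h2)]
  rwa [h.mem_dep_iff hfg.left hfg.right hfg.mem_iff (hA.mem_dep h1)] at h3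

theorem IsGenPoly.right_unique {Q' : BoolFun κ} (hf : ∀ j, ¬ IsConst (f j))
    (h : IsGenPoly P f Q g) (h' : IsGenPoly P f Q' g) : Q = Q' := by
  funext y
  obtain ⟨z, hz⟩ := exists_apply_eq' hf y
  rw [← hz]
  exact (h (fun i j => z j i)).symm.trans (h' _)

theorem IsGenPoly.not_isConst (hg : ∀ i, ¬ IsConst (g i))
    (h : IsGenPoly P f Q g) (hP : ¬ IsConst P) : ¬ IsConst Q := by
  rintro ⟨c, hc⟩
  refine hP ⟨c, fun x => ?_⟩
  obtain ⟨z, hz⟩ := exists_apply_eq' hg x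
  rw [← hz, h z, hc]

theorem two_le_card_of_mem_of_ne {φ : BoolFun ι} {i i' : ι} (h : i ∈ dep φ) (h' : i' ∈ dep φ)
    (hne : i ≠ i') : 2 ≤ (dep φ).card :=
  Finset.one_lt_card.2 ⟨i, h, i', h', hne⟩

/-- The core cells of a component are themselves connected: the others are leaves. -/
theorem IsComponent.core_induction (hfg : IsCompatible f g) (hA : IsComponent g A)
    (T : ι → κ → Prop)
    (hrow : ∀ i j j', (i, j) ∈ A → (i, j') ∈ A → IsCore f g i j → IsCore f g i j' →
      T i j → T i j')
    (hcol : ∀ i i' j, (i, j) ∈ A → (i', j) ∈ A → IsCore f g i j → IsCore f g i' j →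
      T i j → T i' j)
    {i j i' j'} (h : (i, j) ∈ A) (h' : (i', j') ∈ A) (hc : IsCore f g i j)
    (hc' : IsCore f g i' j') (hT : T i j) : T i' j' := by
  let T' : ι → κ → Prop := fun i j => (∀ j', (i, j') ∈ A → IsCore f g i j' → T i j') ∧
    (∀ i', (i', j) ∈ A → IsCore f g i' j → T i' j)
  refine (hA.induction T' ?_ ?_ h h' ⟨fun j' h' hc' => hrow i j j' h h' hc hc' hT,
    fun i' h' hc' => hcol i i' j h h' hc hc' hT⟩).1 j' h' hc'
  · rintro i j j' h1 h2 ⟨h3, h4⟩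
    rcases eq_or_ne j j' with rfl | hne
    · exact ⟨h3, h4⟩
    refine ⟨h3, fun i' h5 h6 => ?_⟩
    have hcore : IsCore f g i j' :=
      ⟨hA.mem_dep h2, two_le_card_of_mem_of_ne (hA.mem_dep h1) (hA.mem_dep h2) hne, h6.2.2⟩
    exact hcol _ _ _ h2 h5 hcore h6 (h3 _ h2 hcore)
  · rintro i i' j h1 h2 ⟨h3, h4⟩
    rcases eq_or_ne i i' with rfl | hne
    · exact ⟨h3, h4⟩
    refine ⟨fun j' h5 h6 => ?_, h4⟩
    have hcore : IsCore f g i' j :=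
      ⟨hA.mem_dep h2, h6.2.1, two_le_card_of_mem_of_ne ((hfg.mem_iff _ _).1 (hA.mem_dep h1))
        ((hfg.mem_iff _ _).1 (hA.mem_dep h2)) hne⟩
    exact hrow _ _ _ h2 h5 hcore h6 (h4 _ h2 hcore)

/-- If a component has a core cell, then each of its cells shares a line with one. -/
theorem IsComponent.exists_core (hfg : IsCompatible f g) (hA : IsComponent g A) {i₀ : ι} {j₀ : κ}
    (h₀ : (i₀, j₀) ∈ A) (hc₀ : IsCore f g i₀ j₀) {i : ι} {j : κ} (h : (i, j) ∈ A) :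
    (∃ j', (i, j') ∈ A ∧ IsCore f g i j') ∨ (∃ i', (i', j) ∈ A ∧ IsCore f g i' j) := by
  refine hA.induction (fun i j => (∃ j', (i, j') ∈ A ∧ IsCore f g i j') ∨
    (∃ i', (i', j) ∈ A ∧ IsCore f g i' j)) ?_ ?_ h₀ h (Or.inl ⟨j₀, h₀, hc₀⟩)
  · rintro i j j' h1 h2 (h3 | ⟨i', h3, h4⟩)
    · exact Or.inl h3
    · rcases eq_or_ne j j' with rfl | hne
      · exact Or.inr ⟨i', h3, h4⟩
      · exact Or.inl ⟨j, h1, hA.mem_dep h1,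
          two_le_card_of_mem_of_ne (hA.mem_dep h1) (hA.mem_dep h2) hne, h4.2.2⟩
  · rintro i i' j h1 h2 (⟨j', h3, h4⟩ | h3)
    · rcases eq_or_ne i i' with rfl | hne
      · exact Or.inl ⟨j', h3, h4⟩
      · exact Or.inr ⟨i, h1, hA.mem_dep h1, h4.2.1,
          two_le_card_of_mem_of_ne ((hfg.mem_iff _ _).1 (hA.mem_dep h1))
            ((hfg.mem_iff _ _).1 (hA.mem_dep h2)) hne⟩
    · exact Or.inr h3

theorem IsComponent.exists_core_of_mem_rowsTwo (hfg : IsCompatible f g) (hA : IsComponent g A)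
    {i₀ : ι} {j₀ : κ} (h₀ : (i₀, j₀) ∈ A) (hc₀ : IsCore f g i₀ j₀) {i : ι}
    (h : i ∈ rowsTwo g A) : ∃ j, (i, j) ∈ A ∧ IsCore f g i j := by
  obtain ⟨h1, h2⟩ := mem_rowsTwo.1 h
  obtain ⟨j, hj⟩ := mem_rows.1 h1
  rcases hA.exists_core hfg h₀ hc₀ hj with h3 | ⟨i', h3, h4⟩
  · exact h3
  · exact ⟨j, hj, hA.mem_dep hj, h2, h4.2.2⟩

/-- In a component with several cells, every cell has a row or a column with at least two cells. -/
theorem IsComponent.two_le_card_or (hfg : IsCompatible f g) (hA : IsComponent g A)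
    (hcard : 1 < A.card) {i : ι} {j : κ} (h : (i, j) ∈ A) :
    2 ≤ (dep (g i)).card ∨ 2 ≤ (dep (f j)).card := by
  by_contra hno
  push Not at hno
  obtain ⟨⟨i', j'⟩, h', hne⟩ := Finset.exists_mem_ne hcard (i, j)
  have : i' = i ∧ j' = j := by
    refine hA.induction (fun i' j' => i' = i ∧ j' = j) ?_ ?_ h h' ⟨rfl, rfl⟩
    · rintro a b b' h1 h2 ⟨rfl, rfl⟩
      refine ⟨rfl, by_contra fun hne => hno.1.not_ge ?_⟩
      exact two_le_card_of_mem_of_ne (hA.mem_dep h2) (hA.mem_dep h1) hne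
    · rintro a a' b h1 h2 ⟨rfl, rfl⟩
      refine ⟨by_contra fun hne => hno.2.not_ge ?_, rfl⟩
      exact two_le_card_of_mem_of_ne ((hfg.mem_iff _ _).1 (hA.mem_dep h2))
        ((hfg.mem_iff _ _).1 (hA.mem_dep h1)) hne
  exact hne (by simp [this])

/-- A family of equations, one for each core cell `(i, j)` of a component, whose outer functions
ignore `i` and `j`, respectively. As the inner functions are onto, either outer function determines
the other one, so by connectedness all equations agree; their outer functions ignore
every line and hence are constant. -/
theorem IsComponent.exists_const (hfg : IsCompatible f g) (hA : IsComponent g A)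
    {p : ι → BoolFun ι} {q : κ → BoolFun κ}
    (h : ∀ i j, (i, j) ∈ A → IsCore f g i j → IsGenPoly (p i) f (q j) g)
    (hp : ∀ i, i ∉ dep (p i)) (hq : ∀ j, j ∉ dep (q j)) (hrows : ∀ i, dep (p i) ⊆ rows A) :
    ∃ v, ∀ i j, (i, j) ∈ A → IsCore f g i j → (∀ x, p i x = v) ∧ ∀ y, q j y = v := by
  by_cases hex : ∃ i j, (i, j) ∈ A ∧ IsCore f g i j
  · obtain ⟨i₀, j₀, h₀, hc₀⟩ := hex
    have hall : ∀ i j, (i, j) ∈ A → IsCore f g i j → p i = p i₀ ∧ q j = q j₀ := by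
      intro i j h1 h2
      refine hA.core_induction hfg (fun i j => p i = p i₀ ∧ q j = q j₀) ?_ ?_ h₀ h1 hc₀ h2
        ⟨rfl, rfl⟩
      · rintro i j j' h1 h2 hc1 hc2 ⟨h3, h4⟩
        exact ⟨h3, ((h i j' h2 hc2).right_unique hfg.left (h i j h1 hc1)).trans h4⟩
      · rintro i i' j h1 h2 hc1 hc2 ⟨h3, h4⟩
        exact ⟨((h i' j h2 hc2).symm.right_unique hfg.right (h i j h1 hc1).symm).trans h3, h4⟩
    have hdep : dep (p i₀) = ∅ := by
      rw [Finset.eq_empty_iff_forall_notMem]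
      intro i hi
      obtain ⟨j, hj⟩ := mem_rows.1 (hrows i₀ hi)
      rcases hA.exists_core hfg h₀ hc₀ hj with ⟨j', h1, h2⟩ | ⟨i', h1, h2⟩
      · rw [← (hall _ _ h1 h2).1] at hi
        exact hp i hi
      · have := ((h i₀ j₀ h₀ hc₀).mem_dep (fun i _ => hfg.right i) hi (hA.mem_dep hj)).1
        rw [← (hall _ _ h1 h2).2] at this
        exact hq j this
    obtain ⟨v, hv⟩ := isConst_of_dep_eq_empty hdep
    refine ⟨v, fun i j h1 h2 => ?_⟩
    rw [(hall i j h1 h2).1, (hall i j h1 h2).2]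
    refine ⟨hv, fun y => ?_⟩
    obtain ⟨z, hz⟩ := exists_apply_eq' hfg.left y
    rw [← hz]
    exact (h i₀ j₀ h₀ hc₀ (fun i j => z j i)).symm.trans (hv _)
  · push Not at hex
    exact ⟨1, fun i j h1 h2 => absurd h2 (hex i j h1)⟩

/-- The outer functions after a cell `(i, j)` of the argument has been modified so that `g i`
becomes `s` and `f j` becomes `t`. -/
theorem IsGenPoly.update_apply (h : IsGenPoly P f Q g) {i : ι} {j : κ} (z : ι → κ → ℤˣ) (c : ℤˣ) :
    P (update (fun i' => g i' (z i')) i (g i (update (z i) j c))) =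
      Q (update (fun j' => f j' (fun i' => z i' j')) j (f j (update (fun i' => z i' j) i c))) := by
  have h1 := h (update z i (update (z i) j c))
  convert h1 using 2
  · funext i'
    by_cases hi' : i' = i
    · subst hi'; simp
    · simp [hi']
  · funext j'
    by_cases hj' : j' = j
    · subst hj'
      simp only [update_self]
      congr 1
      funext i'
      by_cases hi' : i' = i
      · subst hi'; simp
      · simp [hi']
    · rw [update_of_ne hj']
      congr 1
      funext i'
      by_cases hi' : i' = i
      · subst hi'; simp [hj']
      · simp [hi']

theorem XorAt.of_dep_subset_singleton {φ : BoolFun ι} {i : ι} (h : dep φ ⊆ {i})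
    (hne : ¬ IsConst φ) : XorAt φ i := by
  obtain ⟨k, hk⟩ := dep_nonempty hne
  obtain rfl : k = i := by simpa using h hk
  have hd : dep φ = {k} := h.antisymm (by simpa using hk)
  have hdict : IsDictator φ := by simp [IsDictator, hd]
  intro x
  rw [dictator_apply hdict hk, dictator_apply hdict hk x]
  simp

theorem not_mem_dep_flip_mul (φ : BoolFun ι) (i : ι) :
    i ∉ dep (fun x => φ (update x i (-x i)) * φ x) := by
  rw [not_mem_dep]
  intro x c
  simp only [update_self, update_idem]
  rcases eq_or_ne c (x i) with rfl | hne
  · simp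
  · rw [units_eq_neg_of_ne hne, neg_neg, update_eq_self, mul_comm]

theorem IsComponent.xorAt_left_of_core (hfg : IsCompatible f g) (hA : IsComponent g A)
    (h : IsGenPoly P f Q g) (hP : dep P ⊆ rows A) (hne : ¬ IsConst P)
    (hX : ∀ i j, (i, j) ∈ A → IsCore f g i j → XorAt (g i) j ∧ XorAt (f j) i)
    {i : ι} {j : κ} (hij : (i, j) ∈ A) (hc : IsCore f g i j) : XorAt P i := by
  have hgen : ∀ i j, (i, j) ∈ A → IsCore f g i j →
      IsGenPoly (fun x => P (update x i (-x i)) * P x) f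
        (fun y => Q (update y j (-y j)) * Q y) g := by
    intro i j h1 h2 z
    have h3 := h.update_apply (i := i) (j := j) z (-z i j)
    have e1 := (hX i j h1 h2).1 (z i)
    have e2 := (hX i j h1 h2).2 (fun i => z i j)
    rw [e1, e2] at h3
    exact congrArg₂ (· * ·) h3 (h z)
  have hrows : ∀ i, dep (fun x => P (update x i (-x i)) * P x) ⊆ rows A := by
    refine fun i => dep_subset_of_forall fun x y hxy => ?_
    rw [eq_of_eqOn_dep P fun k hk => hxy k (hP hk)]
    congr 1
    refine eq_of_eqOn_dep P fun k hk => ?_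
    by_cases hki : k = i
    · subst hki; simp [hxy k (hP hk)]
    · simp [hki, hxy k (hP hk)]
  obtain ⟨v, hv⟩ := hA.exists_const hfg hgen (not_mem_dep_flip_mul P) (not_mem_dep_flip_mul Q) hrows
  have h1 := (hv i j hij hc).1
  obtain ⟨x, hx⟩ := GeneralizedPolymorphism.mem_dep.1
    (hA.rows_subset_dep hfg h hP hne (mem_rows.2 ⟨j, hij⟩))
  have hv1 : v = -1 := by
    rw [← h1 (update x i 1), update_self, update_idem, units_eq_neg_of_ne hx]
    simp
  intro x
  have := h1 x
  rw [hv1] at this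
  rw [← mul_one (P _), ← Int.units_mul_self (P x), ← mul_assoc, this, neg_one_mul]

/-- In an XOR-like component the outer function is flipped by every row with at least two cells. -/
theorem IsComponent.xorAt_left (hfg : IsCompatible f g) (hA : IsComponent g A)
    (h : IsGenPoly P f Q g) (hP : dep P ⊆ rows A) (hne : ¬ IsConst P)
    (hX : ∀ i j, (i, j) ∈ A → IsCore f g i j → XorAt (g i) j ∧ XorAt (f j) i)
    {i : ι} (hi : i ∈ rowsTwo g A) : XorAt P i := by
  by_cases hex : ∃ i j, (i, j) ∈ A ∧ IsCore f g i j
  · obtain ⟨i₀, j₀, h₀, hc₀⟩ := hex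
    obtain ⟨j, h1, h2⟩ := hA.exists_core_of_mem_rowsTwo hfg h₀ hc₀ hi
    exact hA.xorAt_left_of_core hfg h hP hne hX h1 h2
  · -- Without core cells, the component consists of a single row.
    push Not at hex
    refine XorAt.of_dep_subset_singleton (fun k hk => ?_) hne
    obtain ⟨hi1, hi2⟩ := mem_rowsTwo.1 hi
    obtain ⟨j, hj⟩ := mem_rows.1 hi1
    obtain ⟨l, hl⟩ := mem_rows.1 (hP hk)
    refine Finset.mem_singleton.2 (hA.induction (fun k _ => k = i) (fun _ _ _ _ _ h => h) ?_
      hj hl rfl)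
    rintro a a' b h1 h2 rfl
    by_contra hne
    exact hex _ _ h1 ⟨hA.mem_dep h1, hi2, two_le_card_of_mem_of_ne
      ((hfg.mem_iff _ _).1 (hA.mem_dep h2)) ((hfg.mem_iff _ _).1 (hA.mem_dep h1)) hne⟩

end Component

/-! ### The contributions of a block agree -/

section Eval

variable {ι κ : Type*} [Fintype ι] [DecidableEq ι] [Fintype κ] [DecidableEq κ]
  {f : κ → BoolFun ι} {g : ι → BoolFun κ} {A : Finset (ι × κ)} {a : BoolFun ι} {b : BoolFun κ}

theorem mem_depOne {φ : BoolFun ι} {i : ι} :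
    i ∈ depOne φ g ↔ i ∈ dep φ ∧ IsDictator (g i) := by
  simp [depOne]

theorem mem_depTwo {φ : BoolFun ι} {i : ι} :
    i ∈ depTwo φ g ↔ i ∈ dep φ ∧ 2 ≤ (dep (g i)).card := by
  simp [depTwo]

/-- The sign correction turns the value of a dictator `g i` into its variable. -/
theorem signed_apply (hmem : ∀ i j, j ∈ dep (g i) ↔ i ∈ dep (f j)) (z : ι → κ → ℤˣ) {i : ι} {j : κ}
    (hi : i ∈ depOne (f j) g) : signed g (fun i => g i (z i)) i = z i j := by
  obtain ⟨h1, h2⟩ := mem_depOne.1 hi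
  rw [signed, if_pos h2, dictator_apply h2 ((hmem i j).2 h1), ← mul_assoc, Int.units_mul_self,
    one_mul]

/-- Both iterated products run over the core cells of the block. -/
theorem prod_core_comm {M : Type*} [CommMonoid M] (hmem : ∀ i j, j ∈ dep (g i) ↔ i ∈ dep (f j))
    (hrow : ∀ i j, i ∈ rows A → j ∈ dep (g i) → (i, j) ∈ A)
    (hcol : ∀ i j, j ∈ cols A → j ∈ dep (g i) → (i, j) ∈ A) (t : ι → κ → M) :
    ∏ i ∈ rowsTwo g A, ∏ j ∈ depTwo (g i) f, t i j =
      ∏ j ∈ colsTwo f A, ∏ i ∈ depTwo (f j) g, t i j := by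
  refine Finset.prod_comm' fun i j => ?_
  simp only [mem_rowsTwo, mem_colsTwo, mem_depTwo, ← hmem]
  constructor
  · rintro ⟨⟨h1, h2⟩, h3, h4⟩
    exact ⟨⟨h3, h2⟩, mem_cols.2 ⟨i, hrow i j h1 h3⟩, h4⟩
  · rintro ⟨⟨h1, h2⟩, h3, h4⟩
    exact ⟨⟨mem_rows.2 ⟨j, hcol i j h3 h1⟩, h2⟩, h1, h4⟩

theorem IsSingletonBlock.eval (h : IsSingletonBlock f g A a b) (z : ι → κ → ℤˣ) :
    a (fun i => g i (z i)) = b (fun j => f j (fun i => z i j)) := by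
  obtain ⟨i, j, -, hf, hg, ha, hb⟩ := h
  rw [ha, hb, hf, hg, ← mul_assoc, ← mul_assoc, mul_comm (sgn (g i))]

theorem IsXorBlock.eval (h : IsXorBlock f g A a b)
    (hmem : ∀ i j, j ∈ dep (g i) ↔ i ∈ dep (f j))
    (hrow : ∀ i j, i ∈ rows A → j ∈ dep (g i) → (i, j) ∈ A)
    (hcol : ∀ i j, j ∈ cols A → j ∈ dep (g i) → (i, j) ∈ A) (z : ι → κ → ℤˣ) :
    a (fun i => g i (z i)) = b (fun j => f j (fun i => z i j)) := by
  obtain ⟨-, φ, γ, hf, hg, ha, hb⟩ := h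
  have e1 : ∀ j, (fun i : depOne (f j) g => signed g (fun i => g i (z i)) i) =
      fun i : depOne (f j) g => z i j :=
    fun j => funext fun i => signed_apply hmem z i.2
  have e2 : ∀ i, (fun j : depOne (g i) f => signed f (fun j => f j (fun i => z i j)) j) =
      fun j : depOne (g i) f => z i j :=
    fun i => funext fun j => signed_apply (fun j i => (hmem i j).symm) (fun j i => z i j) j.2
  rw [ha, hb]
  simp only [e1, e2]
  rw [Finset.prod_congr rfl fun i hi => hg i (mem_rowsTwo.1 hi).1 (z i),
    Finset.prod_congr rfl fun j hj => hf j (mem_colsTwo.1 hj).1 (fun i => z i j),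
    Finset.prod_mul_distrib, Finset.prod_mul_distrib, prod_core_comm hmem hrow hcol]
  rw [mul_comm, mul_comm (∏ i ∈ rowsTwo g A, _), mul_assoc]

theorem IsAndOrBlock.eval (h : IsAndOrBlock f g A a b)
    (hmem : ∀ i j, j ∈ dep (g i) ↔ i ∈ dep (f j))
    (hrow : ∀ i j, i ∈ rows A → j ∈ dep (g i) → (i, j) ∈ A)
    (hcol : ∀ i j, j ∈ cols A → j ∈ dep (g i) → (i, j) ∈ A) (z : ι → κ → ℤˣ) :
    a (fun i => g i (z i)) = b (fun j => f j (fun i => z i j)) := by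
  obtain ⟨-, B, D, c, φ, γ, -, -, hf, hg, ha, hb⟩ := h
  have e1 : ∀ j, (fun i : depOne (f j) g => signed g (fun i => g i (z i)) i) =
      fun i : depOne (f j) g => z i j :=
    fun j => funext fun i => signed_apply hmem z i.2
  have e2 : ∀ i, (fun j : depOne (g i) f => signed f (fun j => f j (fun i => z i j)) j) =
      fun j : depOne (g i) f => z i j :=
    fun i => funext fun j => signed_apply (fun j i => (hmem i j).symm) (fun j i => z i j) j.2
  have hsq : ∀ s : ℤˣ, toReal s * toReal s = 1 := fun s => by
    rcases Int.units_eq_one_or s with rfl | rfl <;> simp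
  have hcancel : ∀ (s : ℤˣ) (u v : ℝ),
      (toReal s * (u * (2 * toReal s) * v - toReal s) + 1) / 2 = u * v := fun s u v => by
    linear_combination (u * v - 1 / 2) * hsq s
  apply toReal_injective
  rw [ha, hb]
  simp only [e1, e2]
  have h1 : ∏ i ∈ rowsTwo g A, (toReal (D i) * toReal (g i (z i)) + 1) / 2 =
      ∏ i ∈ rowsTwo g A, (γ i (fun j => z i j) *
        ∏ j ∈ depTwo (g i) f, (toReal (c i j) * toReal (z i j) + 1) / 2) :=
    Finset.prod_congr rfl fun i hi => by rw [hg i hi (z i), hcancel]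
  have h2 : ∏ j ∈ colsTwo f A, (toReal (B j) * toReal (f j fun i => z i j) + 1) / 2 =
      ∏ j ∈ colsTwo f A, (φ j (fun i => z i j) *
        ∏ i ∈ depTwo (f j) g, (toReal (c i j) * toReal (z i j) + 1) / 2) :=
    Finset.prod_congr rfl fun j hj => by rw [hf j hj (fun i => z i j), hcancel]
  rw [h1, h2, Finset.prod_mul_distrib, Finset.prod_mul_distrib,
    prod_core_comm hmem hrow hcol fun i j => (toReal (c i j) * toReal (z i j) + 1) / 2]
  ring

end Eval

/-! ### XOR-like components -/

section Xor

variable {ι κ : Type*} [Fintype ι] [DecidableEq ι] [Fintype κ] [DecidableEq κ]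
  {f : κ → BoolFun ι} {g : ι → BoolFun κ} {A : Finset (ι × κ)} {P : BoolFun ι} {Q : BoolFun κ}

open Classical in
/-- The point that agrees with `u` on `S` and with `d` elsewhere. -/
noncomputable def extend {ι : Type*} (S : Finset ι) (d : Cube ι) (u : Cube S) : Cube ι :=
  fun i => if h : i ∈ S then u ⟨i, h⟩ else d i

theorem extend_of_mem {S : Finset ι} {d : Cube ι} {u : Cube S} {i : ι} (h : i ∈ S) :
    extend S d u i = u ⟨i, h⟩ := dif_pos h

theorem extend_of_notMem {S : Finset ι} {d : Cube ι} {u : Cube S} {i : ι} (h : i ∉ S) :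
    extend S d u i = d i := dif_neg h

theorem restrict_eq (S : Finset ι) (φ : BoolFun ι) (u : Cube S) :
    restrict S φ u = φ (extend S 1 u) := by
  rfl

theorem XorAt.notMem_dep_mul {φ ψ : BoolFun ι} {i : ι} (hφ : XorAt φ i) (hψ : XorAt ψ i) :
    i ∉ dep (fun x => φ x * ψ x) := by
  rw [not_mem_dep]
  intro x c
  rcases eq_or_ne c (x i) with rfl | hne
  · simp
  · rw [units_eq_neg_of_ne hne, hφ, hψ, neg_mul_neg]

theorem xorAt_prod {T : Finset ι} {i : ι} (hi : i ∈ T) :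
    XorAt (fun x => ∏ k ∈ T, x k) i := by
  intro x
  simp only
  rw [← Finset.mul_prod_erase _ _ hi, ← Finset.mul_prod_erase T x hi, update_self, neg_mul]
  congr 2
  exact Finset.prod_congr rfl fun k hk => update_of_ne (Finset.ne_of_mem_erase hk) _ _

/-- A function that is flipped by each coordinate in `T` is the parity of these coordinates times
a function of the remaining ones. -/
theorem eq_restrict_mul_prod {φ : BoolFun ι} {S T : Finset ι} (hS : dep φ ⊆ S ∪ T)
    (hST : Disjoint S T) (h : ∀ i ∈ T, XorAt φ i) (x : Cube ι) :
    φ x = restrict S φ (fun i => x i) * ∏ i ∈ T, x i := by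
  have hdep : ∀ i ∈ dep (fun x => φ x * ∏ i ∈ T, x i), i ∈ S := by
    intro i hi
    by_contra hiS
    by_cases hiT : i ∈ T
    · exact (h i hiT).notMem_dep_mul (xorAt_prod hiT) hi
    · refine not_mem_dep.2 (fun x c => ?_) hi
      have hd : i ∉ dep φ := fun h => by simpa [hiS, hiT] using hS h
      rw [not_mem_dep.1 hd]
      congr 1
      exact Finset.prod_congr rfl fun k hk => update_of_ne (by rintro rfl; exact hiT hk) _ _
  have h1 : φ x * ∏ i ∈ T, x i = φ (extend S 1 fun i => x i) * ∏ i ∈ T, (extend S 1 fun i => x i) i :=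
    eq_of_eqOn_dep (fun x => φ x * ∏ i ∈ T, x i)
      fun i hi => (extend_of_mem (u := fun i : S => x i) (hdep i hi)).symm
  have h2 : ∏ i ∈ T, (extend S 1 fun i => x i) i = 1 :=
    Finset.prod_eq_one fun i hi => extend_of_notMem (Finset.disjoint_right.1 hST hi)
  rw [h2, mul_one] at h1
  rw [restrict_eq, ← h1, mul_assoc, Int.units_mul_self, mul_one]

theorem IsCompatible.dep_subset (hfg : IsCompatible f g) (j : κ) :
    dep (f j) ⊆ depOne (f j) g ∪ depTwo (f j) g := by
  intro i hi
  rw [Finset.mem_union, mem_depOne, mem_depTwo]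
  have : 0 < (dep (g i)).card := Finset.card_pos.2 ⟨j, (hfg.mem_iff i j).2 hi⟩
  rcases Nat.lt_or_ge (dep (g i)).card 2 with h | h
  · exact Or.inl ⟨hi, by unfold IsDictator; omega⟩
  · exact Or.inr ⟨hi, h⟩

theorem disjoint_depOne_depTwo (φ : BoolFun ι) (g : ι → BoolFun κ) :
    Disjoint (depOne φ g) (depTwo φ g) := by
  rw [Finset.disjoint_left]
  intro i h1 h2
  have := (mem_depOne.1 h1).2
  have h3 := (mem_depTwo.1 h2).2
  unfold IsDictator at this
  omega

/-- The contribution of an XOR-like block `A` to the outer function of the rows. -/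
noncomputable def xorPart (f : κ → BoolFun ι) (g : ι → BoolFun κ) (A : Finset (ι × κ)) : BoolFun ι :=
  fun x => (∏ i ∈ rowsTwo g A, x i) *
    ∏ j ∈ colsTwo f A, restrict (depOne (f j) g) (f j) (fun i => signed g x i)

theorem signed_congr {x y : Cube ι} {i : ι} (h : x i = y i) : signed g x i = signed g y i := by
  simp [signed, h]

theorem IsComponent.dep_xorPart_subset (hfg : IsCompatible f g) (hA : IsComponent g A) :
    dep (xorPart f g A) ⊆ rows A := by
  refine dep_subset_of_forall fun x y hxy => ?_
  unfold xorPart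
  congr 1
  · exact Finset.prod_congr rfl fun i hi => hxy i (mem_rowsTwo.1 hi).1
  · refine Finset.prod_congr rfl fun j hj => congrArg _ (funext fun i => signed_congr (hxy i ?_))
    exact mem_rows.2 ⟨j, hA.mem_of_mem_cols hfg (mem_colsTwo.1 hj).1 (mem_depOne.1 i.2).1⟩

theorem xorAt_xorPart {i : ι} (hi : i ∈ rowsTwo g A) : XorAt (xorPart f g A) i := by
  intro x
  unfold xorPart
  rw [← neg_mul]
  congr 1
  · exact xorAt_prod hi x
  · refine Finset.prod_congr rfl fun j hj => congrArg _ (funext fun k => signed_congr ?_)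
    refine update_of_ne ?_ _ _
    rintro rfl
    have h1 := (mem_depOne.1 k.2).2
    have h2 := (mem_rowsTwo.1 hi).2
    unfold IsDictator at h1
    omega

theorem IsComponent.eq_restrict_mul_prod (hfg : IsCompatible f g) (hA : IsComponent g A)
    (hX : ∀ i j, (i, j) ∈ A → IsCore f g i j → XorAt (g i) j ∧ XorAt (f j) i)
    {j : κ} (hj : j ∈ cols A) (x : Cube ι) :
    f j x = restrict (depOne (f j) g) (f j) (fun i => x i) * ∏ i ∈ depTwo (f j) g, x i := by
  refine GeneralizedPolymorphism.eq_restrict_mul_prod (hfg.dep_subset j)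
    (disjoint_depOne_depTwo _ _) (fun i hi => ?_) x
  obtain ⟨h1, h2⟩ := mem_depTwo.1 hi
  have hij := hA.mem_of_mem_cols hfg hj h1
  by_cases h3 : 2 ≤ (dep (f j)).card
  · exact (hX i j hij ⟨hA.mem_dep hij, h2, h3⟩).2
  · refine XorAt.of_dep_subset_singleton (fun k hk => ?_) (hfg.left j)
    by_contra hne
    exact h3 (two_le_card_of_mem_of_ne hk h1 (by simpa using hne))

theorem xorPart_transpose (f : κ → BoolFun ι) (g : ι → BoolFun κ) (A : Finset (ι × κ)) :
    xorPart g f (transpose A) = fun y => (∏ j ∈ colsTwo f A, y j) *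
      ∏ i ∈ rowsTwo g A, restrict (depOne (g i) f) (g i) (fun j => signed f y j) := by
  simp only [← rowsTwo_transpose f A, ← colsTwo_transpose g A]
  rfl

theorem IsComponent.isXorBlock (hfg : IsCompatible f g) (hA : IsComponent g A)
    (hcard : 1 < A.card)
    (hX : ∀ i j, (i, j) ∈ A → IsCore f g i j → XorAt (g i) j ∧ XorAt (f j) i) :
    IsXorBlock f g A (xorPart f g A) (xorPart g f (transpose A)) := by
  refine ⟨hcard, fun j => restrict _ (f j), fun i => restrict _ (g i),
    fun j hj x => hA.eq_restrict_mul_prod hfg hX hj x, fun i hi y => ?_, fun x => rfl, fun y => ?_⟩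
  · refine (hA.symm hfg).eq_restrict_mul_prod hfg.symm (fun j i h1 h2 => ?_) (by simpa using hi) y
    exact (hX i j (mem_transpose.1 h1) (h2.symm hfg.symm)).symm
  · rw [xorPart_transpose]

/-- The outer functions of an XOR-like component are determined up to a common sign: multiplied
by the contributions of the block, they ignore every line with at least two cells, hence all
lines. -/
theorem IsComponent.exists_eq_mul_xorPart (hfg : IsCompatible f g) (hA : IsComponent g A)
    (hcard : 1 < A.card)
    (hX : ∀ i j, (i, j) ∈ A → IsCore f g i j → XorAt (g i) j ∧ XorAt (f j) i)
    (h : IsGenPoly P f Q g) (hP : dep P ⊆ rows A) (hne : ¬ IsConst P) :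
    ∃ ε, ∀ x, P x = ε * xorPart f g A x := by
  have hgen : IsGenPoly (fun x => P x * xorPart f g A x) f
      (fun y => Q y * xorPart g f (transpose A) y) g := fun z => by
    simp only
    rw [h z, (hA.isXorBlock hfg hcard hX).eval hfg.mem_iff
      (fun i j h1 h2 => hA.mem_of_mem_rows h1 h2)
      (fun i j h1 h2 => hA.mem_of_mem_cols hfg h1 ((hfg.mem_iff i j).1 h2)) z]
  have hdep : dep (fun x => P x * xorPart f g A x) = ∅ := by
    rw [Finset.eq_empty_iff_forall_notMem]
    intro i hi
    have hi' : i ∈ rows A := by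
      by_contra hno
      refine not_mem_dep.2 (fun x c => ?_) hi
      rw [not_mem_dep.1 fun h => hno (hP h),
        not_mem_dep.1 fun h => hno (hA.dep_xorPart_subset hfg h)]
    obtain ⟨j, hij⟩ := mem_rows.1 hi'
    rcases hA.two_le_card_or hfg hcard hij with h2 | h2
    · have hi2 := mem_rowsTwo.2 ⟨hi', h2⟩
      exact (hA.xorAt_left hfg h hP hne hX hi2).notMem_dep_mul (xorAt_xorPart hi2) hi
    · have hj := (hgen.mem_dep (fun i _ => hfg.right i) hi (hA.mem_dep hij)).1
      have hj2 : j ∈ rowsTwo f (transpose A) :=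
        mem_rowsTwo.2 ⟨by simpa using mem_cols.2 ⟨i, hij⟩, h2⟩
      refine XorAt.notMem_dep_mul ?_ (xorAt_xorPart hj2) hj
      exact (hA.symm hfg).xorAt_left hfg.symm h.symm
        (by simpa using hA.dep_subset_cols hfg h hP) (h.not_isConst hfg.right hne)
        (fun j i h1 h2 => (hX i j (mem_transpose.1 h1) (h2.symm hfg.symm)).symm) hj2
  obtain ⟨ε, hε⟩ := isConst_of_dep_eq_empty hdep
  refine ⟨ε, fun x => ?_⟩
  rw [← hε x, mul_assoc, Int.units_mul_self, mul_one]

end Xor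

/-! ### AND/OR-like components -/

section AndOr

variable {ι κ : Type*} [Fintype ι] [DecidableEq ι] [Fintype κ] [DecidableEq κ]
  {f : κ → BoolFun ι} {g : ι → BoolFun κ} {A : Finset (ι × κ)} {P : BoolFun ι} {Q : BoolFun κ}

theorem XorAt.not_andAt {φ : BoolFun ι} {i i' : ι} {c : ℤˣ} (hX : XorAt φ i) (hne : i ≠ i')
    (h : AndAt φ i' c) : False := by
  obtain ⟨d, hd⟩ := h
  have h1 := hX (update 1 i' c)
  rw [hd (update 1 i' c) (by simp), hd _ (by simp [hne.symm])] at h1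
  exact units_ne_neg _ h1

/-- If each coordinate `i ∈ T` forces the value `-b` of `φ` unless it equals `κ i`, then `φ` has
the value `b` exactly where no coordinate in `T` forces it and the remaining relevant ones agree. -/
theorem eq_iff_extend_and {φ : BoolFun ι} {S T : Finset ι} (hS : dep φ ⊆ S ∪ T)
    {k : Cube ι} {b : ℤˣ} (h : ∀ i ∈ T, ∀ x, x i = -k i → φ x = -b)
    (x : Cube ι) :
    φ x = b ↔ φ (extend S k fun i => x i) = b ∧ ∀ i ∈ T, x i = k i := by
  have hext : (∀ i ∈ T, x i = k i) → φ x = φ (extend S k fun i => x i) := fun hT => by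
    refine eq_of_eqOn_dep φ fun i hi => ?_
    by_cases hiS : i ∈ S
    · rw [extend_of_mem hiS]
    · rw [extend_of_notMem hiS]
      exact hT i ((Finset.mem_union.1 (hS hi)).resolve_left hiS)
  constructor
  · intro hx
    have hT : ∀ i ∈ T, x i = k i := fun i hi => by
      by_contra hne
      rw [h i hi x (units_eq_neg_of_ne hne)] at hx
      exact units_ne_neg _ hx.symm
    exact ⟨by rw [← hext hT, hx], hT⟩
  · rintro ⟨h1, hT⟩
    rw [hext hT, h1]

/-- The real form of a function that takes the value `b` exactly under a conjunction. -/
theorem toReal_eq_of_iff {φ : BoolFun ι} {p : Cube ι → Prop} [DecidablePred p] {T : Finset ι} {k : Cube ι} {b : ℤˣ}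
    (h : ∀ x, φ x = b ↔ p x ∧ ∀ i ∈ T, x i = k i) (x : Cube ι) :
    toReal (φ x) = (if p x then 1 else 0) * (2 * toReal b) *
      (∏ i ∈ T, (toReal (k i) * toReal (x i) + 1) / 2) - toReal b := by
  simp only [indicator_eq, Finset.prod_boole]
  by_cases hb : φ x = b
  · rw [if_pos ((h x).1 hb).1, if_pos ((h x).1 hb).2, hb]
    ring
  · rw [units_eq_neg_of_ne hb, toReal_neg]
    by_cases h1 : p x
    · rw [if_neg (c := ∀ i ∈ T, x i = k i) fun h2 => hb ((h x).2 ⟨h1, h2⟩)]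
      ring
    · rw [if_neg h1]
      ring

/-- Signs witnessing that all core cells of `A` are of AND type: the value `-k i j` of the variable
`(i, j)` forces `f j` to be `-B j` and `g i` to be `-D i`. -/
structure IsForcing (f : κ → BoolFun ι) (g : ι → BoolFun κ) (A : Finset (ι × κ))
    (B : κ → ℤˣ) (D : ι → ℤˣ) (k : ι → κ → ℤˣ) : Prop where
  left : ∀ {i j}, (i, j) ∈ A → IsCore f g i j → ∀ x : Cube ι, x i = -k i j → f j x = -B j
  right : ∀ {i j}, (i, j) ∈ A → IsCore f g i j → ∀ y : Cube κ, y j = -k i j → g i y = -D i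

theorem exists_forced_value {g : ι → BoolFun κ} {C : ι → κ → Prop} {k : ι → κ → ℤˣ}
    (h : ∀ i j, C i j → AndAt (g i) j (-k i j)) :
    ∃ D : ι → ℤˣ, ∀ i j, C i j → ∀ y : Cube κ, y j = -k i j → g i y = -D i := by
  have : ∀ i, ∃ d : ℤˣ, ∀ j, C i j → ∀ y : Cube κ, y j = -k i j → g i y = -d := by
    intro i
    by_cases hex : ∃ j, C i j
    · obtain ⟨j₀, hj₀⟩ := hex
      obtain ⟨d, hd⟩ := h i j₀ hj₀
      refine ⟨-d, fun j hj y hy => ?_⟩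
      rw [neg_neg]
      obtain ⟨d', hd'⟩ := h i j hj
      -- Both forcing values can be assumed at the same time.
      rw [hd' y hy, ← hd (update (fun j => -k i j) j (-k i j)) (by simp), hd']
      simp
    · push Not at hex
      exact ⟨1, fun j hj => absurd hj (hex j)⟩
  choose D hD using this
  exact ⟨D, hD⟩

theorem IsForcing.symm (hfg : IsCompatible f g) {B : κ → ℤˣ} {D : ι → ℤˣ} {k : ι → κ → ℤˣ}
    (h : IsForcing f g A B D k) : IsForcing g f (transpose A) D B (fun j i => k i j) where
  left h1 h2 := h.right (mem_transpose.1 h1) (h2.symm hfg.symm)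
  right h1 h2 := h.left (mem_transpose.1 h1) (h2.symm hfg.symm)

theorem exists_isForcing
    (h : ∀ i j, (i, j) ∈ A → IsCore f g i j → ∃ c, AndAt (g i) j c ∧ AndAt (f j) i c) :
    ∃ B D k, IsForcing f g A B D k := by
  have : ∀ i j, ∃ k : ℤˣ, (i, j) ∈ A → IsCore f g i j → AndAt (g i) j (-k) ∧ AndAt (f j) i (-k) := by
    intro i j
    by_cases h1 : (i, j) ∈ A ∧ IsCore f g i j
    · obtain ⟨c, hc⟩ := h i j h1.1 h1.2
      exact ⟨-c, fun _ _ => by simpa using hc⟩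
    · exact ⟨1, fun h2 h3 => absurd ⟨h2, h3⟩ h1⟩
  choose k hk using this
  obtain ⟨D, hD⟩ := exists_forced_value (g := g) (C := fun i j => (i, j) ∈ A ∧ IsCore f g i j)
    (k := k) fun i j h => (hk i j h.1 h.2).1
  obtain ⟨B, hB⟩ := exists_forced_value (g := f) (C := fun j i => (i, j) ∈ A ∧ IsCore f g i j)
    (k := fun j i => k i j) fun j i h => (hk i j h.1 h.2).2
  exact ⟨B, D, k, fun h1 h2 => hB _ _ ⟨h1, h2⟩, fun h1 h2 => hD _ _ ⟨h1, h2⟩⟩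

theorem IsForcing.eq_iff (hfg : IsCompatible f g) (hA : IsComponent g A) {B : κ → ℤˣ} {D : ι → ℤˣ}
    {k : ι → κ → ℤˣ} (h : IsForcing f g A B D k) {j : κ} (hj : j ∈ colsTwo f A) (x : Cube ι) :
    f j x = B j ↔ f j (extend (depOne (f j) g) (fun i => k i j) fun i => x i) = B j ∧
      ∀ i ∈ depTwo (f j) g, x i = k i j := by
  refine eq_iff_extend_and (hfg.dep_subset j) (fun i hi x hx => ?_) x
  obtain ⟨h1, h2⟩ := mem_depTwo.1 hi
  have hij := hA.mem_of_mem_cols hfg (mem_colsTwo.1 hj).1 h1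
  exact h.left hij ⟨hA.mem_dep hij, h2, (mem_colsTwo.1 hj).2⟩ x hx

/-- The contribution of an AND/OR-like block `A` to the outer function of the rows. -/
noncomputable def andPart (f : κ → BoolFun ι) (g : ι → BoolFun κ) (A : Finset (ι × κ))
    (B : κ → ℤˣ) (D : ι → ℤˣ) (k : ι → κ → ℤˣ) : BoolFun ι := fun x =>
  if (∀ j ∈ colsTwo f A,
    f j (extend (depOne (f j) g) (fun i => k i j) fun i => signed g x i) = B j) ∧
    ∀ i ∈ rowsTwo g A, x i = D i then 1 else -1

theorem andPart_eq_one_iff {B : κ → ℤˣ} {D : ι → ℤˣ} {k : ι → κ → ℤˣ} {x : Cube ι} :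
    andPart f g A B D k x = 1 ↔ (∀ j ∈ colsTwo f A,
      f j (extend (depOne (f j) g) (fun i => k i j) fun i => signed g x i) = B j) ∧
      ∀ i ∈ rowsTwo g A, x i = D i := by
  unfold andPart
  split_ifs with h
  · exact iff_of_true rfl h
  · exact iff_of_false (by decide) h

theorem toReal_andPart (B : κ → ℤˣ) (D : ι → ℤˣ) (k : ι → κ → ℤˣ) (x : Cube ι) :
    toReal (andPart f g A B D k x) =
      2 * (∏ i ∈ rowsTwo g A, (toReal (D i) * toReal (x i) + 1) / 2) *
        (∏ j ∈ colsTwo f A,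
          if f j (extend (depOne (f j) g) (fun i => k i j) fun i => signed g x i) = B j
          then 1 else 0) - 1 := by
  rw [toReal_eq_of_iff (b := 1) (fun x => andPart_eq_one_iff), toReal_one, Finset.prod_boole]
  ring_nf

theorem IsComponent.isAndOrBlock (hfg : IsCompatible f g) (hA : IsComponent g A)
    (hcard : 1 < A.card) {B : κ → ℤˣ} {D : ι → ℤˣ} {k : ι → κ → ℤˣ} (h : IsForcing f g A B D k) :
    IsAndOrBlock f g A (andPart f g A B D k)
      (andPart g f (transpose A) D B fun j i => k i j) := by
  refine ⟨hcard, B, D, k,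
    fun j u => if f j (extend (depOne (f j) g) (fun i => k i j) u) = B j then 1 else 0,
    fun i v => if g i (extend (depOne (g i) f) (k i) v) = D i then 1 else 0,
    fun j u => ?_, fun i v => ?_, fun j hj x => toReal_eq_of_iff (h.eq_iff hfg hA hj) x,
    fun i hi y => ?_, fun x => toReal_andPart B D k x, fun y => ?_⟩
  · dsimp only
    split_ifs <;> simp
  · dsimp only
    split_ifs <;> simp
  · exact toReal_eq_of_iff ((h.symm hfg).eq_iff hfg.symm (hA.symm hfg)
      (by rwa [colsTwo_transpose])) y
  · rw [toReal_andPart, rowsTwo_transpose, colsTwo_transpose]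

/-- Forcing any core cell of an AND/OR-like component yields the same value of the outer
functions. -/
theorem IsForcing.exists_value (hfg : IsCompatible f g) (hA : IsComponent g A)
    {B : κ → ℤˣ} {D : ι → ℤˣ} {k : ι → κ → ℤˣ} (hF : IsForcing f g A B D k)
    (h : IsGenPoly P f Q g) (hP : dep P ⊆ rows A) :
    ∃ v, ∀ i j, (i, j) ∈ A → IsCore f g i j →
      (∀ x, x i = -D i → P x = v) ∧ ∀ y, y j = -B j → Q y = v := by
  obtain ⟨v, hv⟩ := hA.exists_const hfg (p := fun i x => P (update x i (-D i)))
    (q := fun j y => Q (update y j (-B j)))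
    (fun i j h1 h2 z => by
      have h3 := h.update_apply (i := i) (j := j) z (-k i j)
      rwa [hF.right h1 h2 _ (by simp), hF.left h1 h2 _ (by simp)] at h3)
    (fun i => not_mem_dep.2 fun x c => by simp) (fun j => not_mem_dep.2 fun x c => by simp)
    (fun i => dep_subset_of_forall fun x y hxy => eq_of_eqOn_dep P fun l hl => by
      by_cases hli : l = i
      · subst hli; simp
      · simp [hli, hxy l (hP hl)])
  refine ⟨v, fun i j h1 h2 => ⟨fun x hx => ?_, fun y hy => ?_⟩⟩
  · rw [← (hv i j h1 h2).1 x, ← hx, update_eq_self]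
  · rw [← (hv i j h1 h2).2 y, ← hy, update_eq_self]

/-- The outer functions of an AND/OR-like component are determined up to a common sign: they take
the value different from the forced one exactly where the contribution of the block is `1`. -/
theorem IsComponent.exists_eq_mul_andPart (hfg : IsCompatible f g) (hA : IsComponent g A)
    (hcard : 1 < A.card) {i₀ : ι} {j₀ : κ} (h₀ : (i₀, j₀) ∈ A) (hc₀ : IsCore f g i₀ j₀)
    {B : κ → ℤˣ} {D : ι → ℤˣ} {k : ι → κ → ℤˣ} (hF : IsForcing f g A B D k)
    (h : IsGenPoly P f Q g) (hP : dep P ⊆ rows A) (hne : ¬ IsConst P) :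
    ∃ ε, ∀ x, P x = ε * andPart f g A B D k x := by
  obtain ⟨v, hv⟩ := hF.exists_value hfg hA h hP
  have hP1 : ∀ i ∈ rowsTwo g A, ∀ x, x i = -D i → P x = v := fun i hi x hx => by
    obtain ⟨j, h1, h2⟩ := hA.exists_core_of_mem_rowsTwo hfg h₀ hc₀ hi
    exact (hv i j h1 h2).1 x hx
  have hQ1 : ∀ j ∈ colsTwo f A, ∀ y, y j = -B j → Q y = v := fun j hj y hy => by
    obtain ⟨i, h1, h2⟩ := (hA.symm hfg).exists_core_of_mem_rowsTwo hfg.symm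
      (mem_transpose.2 h₀) (hc₀.symm hfg) (by rwa [rowsTwo_transpose])
    exact (hv i j (mem_transpose.1 h1) (h2.symm hfg.symm)).2 y hy
  have hsgn : ∀ (z : ι → κ → ℤˣ) j, (fun i : depOne (f j) g => signed g (fun i => g i (z i)) i) =
      fun i : depOne (f j) g => z i j :=
    fun z j => funext fun i => signed_apply hfg.mem_iff z i.2
  have hone : ∀ x, P x ≠ v → andPart f g A B D k x = 1 := by
    intro x hx
    refine andPart_eq_one_iff.2 ⟨fun j hj => ?_, fun i hi => ?_⟩
    · by_contra hno
      obtain ⟨z, rfl⟩ := exists_apply_eq' hfg.right x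
      apply hx
      rw [hsgn] at hno
      rw [h z]
      refine hQ1 j hj _ (units_eq_neg_of_ne fun hB => hno ?_)
      exact ((hF.eq_iff hfg hA hj _).1 hB).1
    · by_contra hno
      exact hx (hP1 i hi x (units_eq_neg_of_ne hno))
  obtain ⟨x₀, hx₀⟩ := exists_eq_of_not_isConst hne (-v)
  have hx₀' : P x₀ ≠ v := fun h' => units_ne_neg v (h'.symm.trans hx₀)
  have ha₀ := andPart_eq_one_iff.1 (hone x₀ hx₀')
  -- Any other point with contribution `1` is reached by a matrix with the same column values.
  have hback : ∀ x, andPart f g A B D k x = 1 → P x = -v := by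
    intro x hx
    have ha := andPart_eq_one_iff.1 hx
    obtain ⟨z₀, hz₀⟩ := exists_apply_eq' hfg.right x₀
    obtain ⟨z₁, hz₁⟩ := exists_apply_eq' hfg.right x
    set z : ι → κ → ℤˣ := fun i => if i ∈ rowsTwo g A then z₀ i else z₁ i with hz
    have hzx : (fun i => g i (z i)) = x := by
      funext i
      by_cases hi : i ∈ rowsTwo g A
      · simp only [hz, if_pos hi]
        rw [ha.2 i hi, ← ha₀.2 i hi, ← hz₀]
      · simp only [hz, if_neg hi]
        rw [← hz₁]
    have hcell : ∀ i j, j ∈ colsTwo f A → i ∈ depTwo (f j) g → z₀ i j = k i j := by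
      intro i j hj hi
      obtain ⟨h1, h2⟩ := mem_depTwo.1 hi
      have hij := hA.mem_of_mem_cols hfg (mem_colsTwo.1 hj).1 h1
      have hi2 : i ∈ rowsTwo g A := mem_rowsTwo.2 ⟨mem_rows.2 ⟨j, hij⟩, h2⟩
      by_contra hno
      have h3 := hF.right hij ⟨hA.mem_dep hij, h2, (mem_colsTwo.1 hj).2⟩ (z₀ i)
        (units_eq_neg_of_ne hno)
      have h4 := ha₀.2 i hi2
      rw [← hz₀] at h4
      exact units_ne_neg _ (h4.symm.trans h3)
    rw [← hx₀, ← hzx, ← hz₀, h z, h z₀]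
    refine eq_of_eqOn_dep Q fun j hj => ?_
    have hj' := hA.dep_subset_cols hfg h hP hj
    by_cases hj2 : 2 ≤ (dep (f j)).card
    · have hj3 := mem_colsTwo.2 ⟨hj', hj2⟩
      have e1 : f j (fun i => z i j) = B j := by
        refine (hF.eq_iff hfg hA hj3 _).2 ⟨?_, fun i hi => ?_⟩
        · rw [← hsgn z, hzx]
          exact ha.1 j hj3
        · obtain ⟨h1, h2⟩ := mem_depTwo.1 hi
          have hij := hA.mem_of_mem_cols hfg hj' h1
          have hi2 : i ∈ rowsTwo g A := mem_rowsTwo.2 ⟨mem_rows.2 ⟨j, hij⟩, h2⟩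
          simp only [hz, if_pos hi2]
          exact hcell i j hj3 hi
      have e2 : f j (fun i => z₀ i j) = B j := by
        refine (hF.eq_iff hfg hA hj3 _).2 ⟨?_, fun i hi => hcell i j hj3 hi⟩
        rw [← hsgn z₀, hz₀]
        exact ha₀.1 j hj3
      rw [e1, e2]
    · refine eq_of_eqOn_dep _ fun i hi => ?_
      have hij := hA.mem_of_mem_cols hfg hj' hi
      have hi2 : i ∈ rowsTwo g A := mem_rowsTwo.2 ⟨mem_rows.2 ⟨j, hij⟩,
        (hA.two_le_card_or hfg hcard hij).resolve_right hj2⟩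
      simp only [hz, if_pos hi2]
  refine ⟨-v, fun x => ?_⟩
  rcases eq_or_ne (andPart f g A B D k x) 1 with h1 | h1
  · rw [h1, hback x h1, mul_one]
  · rw [units_eq_neg_of_ne h1, mul_neg, mul_one, neg_neg]
    by_contra hx
    exact h1 (hone x hx)

end AndOr

/-! ### The classification of a component -/

section Classification

variable {ι κ : Type*} [Fintype ι] [DecidableEq ι] [Fintype κ] [DecidableEq κ]
  {f : κ → BoolFun ι} {g : ι → BoolFun κ} {A : Finset (ι × κ)} {P : BoolFun ι} {Q : BoolFun κ}

/-- By connectedness, all core cells of a component are of the same type. -/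
theorem IsComponent.all_xorAt_or_all_andAt (hfg : IsCompatible f g) (hA : IsComponent g A)
    (h : IsGenPoly P f Q g) (hP : dep P ⊆ rows A) (hne : ¬ IsConst P) :
    (∀ i j, (i, j) ∈ A → IsCore f g i j → XorAt (g i) j ∧ XorAt (f j) i) ∨
    ((∃ i j, (i, j) ∈ A ∧ IsCore f g i j) ∧
      ∀ i j, (i, j) ∈ A → IsCore f g i j → ∃ c, AndAt (g i) j c ∧ AndAt (f j) i c) := by
  have hdich : ∀ i j, (i, j) ∈ A → IsCore f g i j → _ := fun i j h1 h2 =>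
    h.xorAt_or_andAt hfg.right h2 (hA.rows_subset_dep hfg h hP hne (mem_rows.2 ⟨j, h1⟩))
  by_cases hall : ∀ i j, (i, j) ∈ A → IsCore f g i j → XorAt (g i) j ∧ XorAt (f j) i
  · exact Or.inl hall
  · push Not at hall
    obtain ⟨i₀, j₀, h₀, hc₀, hno⟩ := hall
    refine Or.inr ⟨⟨i₀, j₀, h₀, hc₀⟩, fun i j h1 h2 => (hdich i j h1 h2).resolve_left fun hX => ?_⟩
    have := hA.core_induction hfg (fun i j => XorAt (g i) j ∧ XorAt (f j) i) ?_ ?_ h1 h₀ h2 hc₀ hX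
    · exact hno this.1 this.2
    · intro i j j' _ h4 _ h6 h7
      rcases eq_or_ne j j' with rfl | hjj
      · exact h7
      · exact (hdich i j' h4 h6).resolve_right fun ⟨c, hc, _⟩ => h7.1.not_andAt hjj hc
    · intro i i' j _ h4 _ h6 h7
      rcases eq_or_ne i i' with rfl | hii
      · exact h7
      · exact (hdich i' j h4 h6).resolve_right fun ⟨c, _, hc⟩ => h7.2.not_andAt hii hc

theorem IsComponent.dep_eq_singleton (hA : IsComponent g A) {i : ι} {j : κ}
    (h : A = {(i, j)}) : dep (g i) = {j} := by
  have hij : (i, j) ∈ A := by simp [h]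
  ext j'
  rw [Finset.mem_singleton]
  refine ⟨fun hj' => ?_, fun hj' => hj' ▸ hA.mem_dep hij⟩
  simpa [h] using hA.row_closed hij hj'

/-- The non-constant outer functions of a component have one of the three standard forms, and they
are determined up to a common sign by the inner functions. -/
theorem IsComponent.exists_block (hfg : IsCompatible f g) (hA : IsComponent g A)
    (h : IsGenPoly P f Q g) (hP : dep P ⊆ rows A) (hne : ¬ IsConst P) :
    ∃ a b, (IsSingletonBlock f g A a b ∨ IsXorBlock f g A a b ∨ IsAndOrBlock f g A a b) ∧
      ∀ P Q, IsGenPoly P f Q g → dep P ⊆ rows A → ¬ IsConst P → ∃ ε, ∀ x, P x = ε * a x := by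
  rcases Nat.lt_or_ge 1 A.card with hcard | hcard
  · rcases hA.all_xorAt_or_all_andAt hfg h hP hne with hX | ⟨⟨i₀, j₀, h₀, hc₀⟩, hand⟩
    · exact ⟨_, _, Or.inr (Or.inl (hA.isXorBlock hfg hcard hX)),
        fun P Q h hP hne => hA.exists_eq_mul_xorPart hfg hcard hX h hP hne⟩
    · obtain ⟨B, D, k, hF⟩ := exists_isForcing hand
      exact ⟨_, _, Or.inr (Or.inr (hA.isAndOrBlock hfg hcard hF)),
        fun P Q h hP hne => hA.exists_eq_mul_andPart hfg hcard h₀ hc₀ hF h hP hne⟩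
  · obtain ⟨⟨i, j⟩, hij⟩ := Finset.card_eq_one.1 (hcard.antisymm hA.nonempty.card_pos)
    have hg := hA.dep_eq_singleton hij
    have hf : dep (f j) = {i} := (hA.symm hfg).dep_eq_singleton (by simp [hij, transpose])
    refine ⟨fun x => sgn (f j) * x i, fun y => sgn (g i) * y j,
      Or.inl ⟨i, j, hij, fun x => ?_, fun y => ?_, fun x => rfl, fun y => rfl⟩,
      fun P Q h hP hne => ?_⟩
    · exact dictator_apply (by simp [IsDictator, hf]) (by simp [hf]) x
    · exact dictator_apply (by simp [IsDictator, hg]) (by simp [hg]) y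
    · have hrows : rows A = {i} := by simp [hij, rows]
      have hd : dep P = {i} := (hrows ▸ hP).antisymm (hrows ▸ hA.rows_subset_dep hfg h hP hne)
      refine ⟨sgn P * sgn (f j), fun x => ?_⟩
      rw [dictator_apply (φ := P) (i := i) (by simp [IsDictator, hd]) (by simp [hd]) x, mul_assoc,
        ← mul_assoc (sgn (f j)), Int.units_mul_self, one_mul]

end Classification

/-! ### The partition into connected components -/

section Partition

variable {ι κ : Type*} [Fintype ι] [DecidableEq ι] [Fintype κ] [DecidableEq κ]
  {f : κ → BoolFun ι} {g : ι → BoolFun κ} {A : Finset (ι × κ)}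

theorem mem_cells {g : ι → BoolFun κ} {i : ι} {j : κ} : (i, j) ∈ cells g ↔ j ∈ dep (g i) := by
  simp [cells]

/-- Two cells of `Z` share a row or a column. -/
def Linked (Z : Finset (ι × κ)) (p q : ι × κ) : Prop :=
  p ∈ Z ∧ q ∈ Z ∧ (p.1 = q.1 ∨ p.2 = q.2)

open Classical in
/-- The partition of the cells into the classes of the equivalence relation generated by sharing a
row or a column. -/
noncomputable def componentPartition (g : ι → BoolFun κ) : Finpartition (cells g) :=
  Finpartition.ofSetSetoid (Relation.EqvGen.setoid (Linked (cells g))) (cells g)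

theorem isComponent_of_mem_parts (hA : A ∈ (componentPartition g).parts) : IsComponent g A := by
  classical
  have hne := (componentPartition g).nonempty_of_mem_parts hA
  obtain ⟨p₀, -, rfl⟩ := Finset.mem_image.1 hA
  have hmem : ∀ p, p ∈ (cells g).filter (fun q => Relation.EqvGen (Linked (cells g)) p₀ q) ↔
      p ∈ cells g ∧ Relation.EqvGen (Linked (cells g)) p₀ p := fun p => Finset.mem_filter
  change IsComponent g ((cells g).filter (fun q => Relation.EqvGen (Linked (cells g)) p₀ q))
  set A := (cells g).filter (fun q => Relation.EqvGen (Linked (cells g)) p₀ q) with hA'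
  refine ⟨hne, fun h => mem_cells.1 ((hmem _).1 h).1, fun {i j j'} h h' => ?_,
    fun {i i' j} h h' => ?_, fun T hrow hcol i j i' j' h h' hT => ?_⟩
  · obtain ⟨h1, h2⟩ := (hmem _).1 h
    exact (hmem _).2 ⟨mem_cells.2 h', h2.trans _ _ _ (.rel _ _ ⟨h1, mem_cells.2 h', .inl rfl⟩)⟩
  · obtain ⟨h1, h2⟩ := (hmem _).1 h
    exact (hmem _).2 ⟨mem_cells.2 h', h2.trans _ _ _ (.rel _ _ ⟨h1, mem_cells.2 h', .inr rfl⟩)⟩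
  · have key : ∀ p q, Relation.EqvGen (Linked (cells g)) p q →
        (p ∈ A ↔ q ∈ A) ∧ (p ∈ A → (T p.1 p.2 ↔ T q.1 q.2)) := by
      intro p q hpq
      induction hpq with
      | rel p q hl =>
        have hl' : Linked (cells g) q p := ⟨hl.2.1, hl.1, hl.2.2.imp Eq.symm Eq.symm⟩
        have hiff : p ∈ A ↔ q ∈ A := by
          rw [hmem, hmem]
          exact ⟨fun h => ⟨hl.2.1, h.2.trans _ _ _ (.rel _ _ hl)⟩,
            fun h => ⟨hl.1, h.2.trans _ _ _ (.rel _ _ hl')⟩⟩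
        refine ⟨hiff, fun hp => ?_⟩
        have hq := hiff.1 hp
        obtain ⟨i, j⟩ := p
        obtain ⟨i', j'⟩ := q
        rcases hl.2.2 with h | h
        · obtain rfl : i = i' := h
          exact ⟨hrow _ _ _ hp hq, hrow _ _ _ hq hp⟩
        · obtain rfl : j = j' := h
          exact ⟨hcol _ _ _ hp hq, hcol _ _ _ hq hp⟩
      | refl p => exact ⟨Iff.rfl, fun _ => Iff.rfl⟩
      | symm p q _ ih => exact ⟨ih.1.symm, fun h => (ih.2 (ih.1.2 h)).symm⟩
      | trans p q r _ _ ih₁ ih₂ =>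
        exact ⟨ih₁.1.trans ih₂.1, fun h => (ih₁.2 h).trans (ih₂.2 (ih₁.1.1 h))⟩
    have h1 := ((hmem _).1 h).2
    have h2 := ((hmem _).1 h').2
    exact ((key _ _ ((h1.symm _ _).trans _ _ _ h2)).2 h).1 hT

theorem IsComponent.connected (hA : IsComponent g A) :
    ((cellGraph ι κ).induce (A : Set (ι × κ))).Connected := by
  rw [SimpleGraph.connected_iff_exists_forall_reachable]
  obtain ⟨⟨i₀, j₀⟩, h₀⟩ := hA.nonempty
  refine ⟨⟨(i₀, j₀), h₀⟩, fun ⟨⟨i, j⟩, h⟩ => ?_⟩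
  have step : ∀ p q : (A : Set (ι × κ)), (p.1.1 = q.1.1 ∨ p.1.2 = q.1.2) →
      ((cellGraph ι κ).induce (A : Set (ι × κ))).Reachable ⟨(i₀, j₀), h₀⟩ p →
      ((cellGraph ι κ).induce (A : Set (ι × κ))).Reachable ⟨(i₀, j₀), h₀⟩ q := by
    intro p q hpq hp
    rcases eq_or_ne p q with rfl | hne
    · exact hp
    · refine hp.trans (SimpleGraph.Adj.reachable ?_)
      exact ⟨fun h => hne (Subtype.ext h), hpq⟩
  have := hA.induction (fun i j => ∃ h : (i, j) ∈ A,
    ((cellGraph ι κ).induce (A : Set (ι × κ))).Reachable ⟨(i₀, j₀), h₀⟩ ⟨(i, j), h⟩)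
    (fun i j j' h1 h2 ⟨_, h3⟩ => ⟨h2, step ⟨_, h1⟩ ⟨_, h2⟩ (Or.inl rfl) h3⟩)
    (fun i i' j h1 h2 ⟨_, h3⟩ => ⟨h2, step ⟨_, h1⟩ ⟨_, h2⟩ (Or.inr rfl) h3⟩) h₀ h ⟨h₀, .refl _⟩
  exact this.2

theorem eq_of_mem_parts {Z : Finset (ι × κ)} {P : Finpartition Z} {A B : Finset (ι × κ)}
    (hA : A ∈ P.parts) (hB : B ∈ P.parts) {p : ι × κ} (hpA : p ∈ A) (hpB : p ∈ B) : A = B := by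
  by_contra hne
  exact Finset.disjoint_left.1 (P.disjoint hA hB hne) hpA hpB

theorem isBlockPartition_componentPartition (g : ι → BoolFun κ) :
    IsBlockPartition (componentPartition g) := by
  intro A hA B hB hne
  have hA' := isComponent_of_mem_parts hA
  have hB' := isComponent_of_mem_parts hB
  refine ⟨Finset.disjoint_left.2 fun i h1 h2 => ?_, Finset.disjoint_left.2 fun j h1 h2 => ?_⟩
  · obtain ⟨j, hj⟩ := mem_rows.1 h2
    exact hne (eq_of_mem_parts hA hB (hA'.mem_of_mem_rows h1 (hB'.mem_dep hj)) hj)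
  · obtain ⟨i, hi⟩ := mem_cols.1 h1
    obtain ⟨i', hi'⟩ := mem_cols.1 h2
    exact hne (eq_of_mem_parts hA hB (hA'.col_closed hi (hB'.mem_dep hi')) hi')

/-! ### The block form of a reduced equation -/

theorem IsGenPoly.of_hasBlockForm {F : BoolFun ι} {G : BoolFun κ} {P : Finpartition (cells g)}
    (hP : IsBlockPartition P) (h : HasBlockForm F f G g P) : IsGenPoly F f G g := by
  obtain ⟨hmem, H, a, b, -, hF, hG, hab⟩ := h
  intro z
  rw [hF, hG]
  congr 1
  funext A
  have hrow : ∀ i j, i ∈ rows A.1 → j ∈ dep (g i) → (i, j) ∈ A.1 := by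
    intro i j hi hj
    obtain ⟨B, hB, hij⟩ := P.exists_mem (mem_cells.2 hj)
    by_contra hno
    have hne : A.1 ≠ B := by rintro h; exact hno (h ▸ hij)
    exact Finset.disjoint_left.1 (hP A.1 A.2 B hB hne).1 hi (mem_rows.2 ⟨j, hij⟩)
  have hcol : ∀ i j, j ∈ cols A.1 → j ∈ dep (g i) → (i, j) ∈ A.1 := by
    intro i j hi hj
    obtain ⟨B, hB, hij⟩ := P.exists_mem (mem_cells.2 hj)
    by_contra hno
    have hne : A.1 ≠ B := by rintro h; exact hno (h ▸ hij)
    exact Finset.disjoint_left.1 (hP A.1 A.2 B hB hne).2 hi (mem_cols.2 ⟨i, hij⟩)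
  rcases hab A with h | h | h
  · exact h.eval z
  · exact h.eval hmem hrow hcol z
  · exact h.eval hmem hrow hcol z

/-- `F` with the coordinates outside `S` fixed to those of `u`. -/
def freeze (F : BoolFun ι) (S : Finset ι) (u : Cube ι) : BoolFun ι :=
  fun x => F fun i => if i ∈ S then x i else u i

theorem dep_freeze_subset (F : BoolFun ι) (S : Finset ι) (u : Cube ι) :
    dep (freeze F S u) ⊆ S := by
  refine dep_subset_of_forall fun x y hxy => congrArg F (funext fun i => ?_)
  by_cases hi : i ∈ S
  · simp only [if_pos hi, hxy i hi]
  · simp only [if_neg hi]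

/-- Fixing the cells outside a component in an equation gives an equation for the component. -/
theorem IsComponent.exists_isGenPoly_freeze (hfg : IsCompatible f g) (hA : IsComponent g A)
    {F : BoolFun ι} {G : BoolFun κ} (h : IsGenPoly F f G g) (u : Cube ι) :
    ∃ Q, IsGenPoly (freeze F (rows A) u) f Q g := by
  obtain ⟨z₀, rfl⟩ := exists_apply_eq' hfg.right u
  refine ⟨freeze G (cols A) fun j => f j fun i => z₀ i j, fun z => ?_⟩
  have h1 := h fun i => if i ∈ rows A then z i else z₀ i
  unfold freeze
  convert h1 using 2
  · funext i
    split_ifs <;> rfl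
  · funext j
    have hiff : ∀ i ∈ dep (f j), (i ∈ rows A ↔ j ∈ cols A) := fun i hi =>
      ⟨fun h => mem_cols.2 ⟨i, hA.mem_of_mem_rows h ((hfg.mem_iff i j).2 hi)⟩,
        fun h => mem_rows.2 ⟨j, hA.mem_of_mem_cols hfg h hi⟩⟩
    by_cases hj : j ∈ cols A
    · rw [if_pos hj]
      exact eq_of_eqOn_dep _ fun i hi => by rw [if_pos ((hiff i hi).2 hj)]
    · rw [if_neg hj]
      exact eq_of_eqOn_dep _ fun i hi => by rw [if_neg fun h => hj ((hiff i hi).1 h)]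

/-- A component comes with a contribution `a` to the outer function `F` that carries all the
information about its rows that is relevant for `F`. -/
theorem IsComponent.exists_contribution (hfg : IsCompatible f g) (hA : IsComponent g A)
    {F : BoolFun ι} {G : BoolFun κ} (h : IsGenPoly F f G g) (hF : dep F = Finset.univ) :
    ∃ a b, (IsSingletonBlock f g A a b ∨ IsXorBlock f g A a b ∨ IsAndOrBlock f g A a b) ∧
      dep a ⊆ rows A ∧ ¬ IsConst a ∧
      ∀ x y, (∀ i ∉ rows A, x i = y i) → a x = a y → F x = F y := by
  obtain ⟨⟨i, j⟩, hij⟩ := hA.nonempty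
  have hi : i ∈ rows A := mem_rows.2 ⟨j, hij⟩
  obtain ⟨u, hu⟩ := GeneralizedPolymorphism.mem_dep.1 (hF ▸ Finset.mem_univ i : i ∈ dep F)
  have hfr : ∀ c, freeze F (rows A) u (update u i c) = F (update u i c) := fun c => by
    unfold freeze
    congr 1
    funext k
    split_ifs with hk
    · rfl
    · rw [update_of_ne (by rintro rfl; exact hk hi)]
  have hne : ¬ IsConst (freeze F (rows A) u) :=
    not_isConst_of_mem_dep (i := i) (GeneralizedPolymorphism.mem_dep.2 ⟨u, by rwa [hfr, hfr]⟩)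
  obtain ⟨Q, hQ⟩ := hA.exists_isGenPoly_freeze hfg h u
  obtain ⟨a, b, hab, huniq⟩ := hA.exists_block hfg hQ (dep_freeze_subset _ _ _) hne
  obtain ⟨ε, hε⟩ := huniq _ _ hQ (dep_freeze_subset _ _ _) hne
  have ha : ∀ x, a x = ε * freeze F (rows A) u x := fun x => by
    rw [hε, ← mul_assoc, Int.units_mul_self, one_mul]
  refine ⟨a, b, hab, dep_subset_of_forall fun x y hxy => ?_, ?_, fun x y hxy hax => ?_⟩
  · rw [ha, ha, eq_of_eqOn_dep (freeze F (rows A) u) fun k hk => hxy k (dep_freeze_subset _ _ _ hk)]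
  · rintro ⟨c, hc⟩
    exact hne ⟨ε * c, fun x => by rw [hε, hc]⟩
  · have hx : freeze F (rows A) x x = F x := by simp [freeze]
    have hy : freeze F (rows A) x y = F y := by
      unfold freeze
      congr 1
      funext k
      split_ifs with hk
      · rfl
      · exact hxy k hk
    rw [← hx, ← hy]
    by_cases hc : IsConst (freeze F (rows A) x)
    · obtain ⟨c, hc⟩ := hc
      rw [hc, hc]
    · obtain ⟨Q', hQ'⟩ := hA.exists_isGenPoly_freeze hfg h x
      obtain ⟨δ, hδ⟩ := huniq _ _ hQ' (dep_freeze_subset _ _ _) hc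
      rw [hδ, hδ, hax]

/-- A reduced equation has block form with respect to its connected components. -/
theorem IsGenPoly.hasBlockForm (hfg : IsCompatible f g) {F : BoolFun ι} {G : BoolFun κ}
    (h : IsGenPoly F f G g) (hF : dep F = Finset.univ) :
    HasBlockForm F f G g (componentPartition g) := by
  classical
  refine ⟨hfg.mem_iff, ?_⟩
  have hcomp : ∀ A : (componentPartition g).parts, IsComponent g A.1 := fun A =>
    isComponent_of_mem_parts A.2
  choose a b hab hdep hne hdet using fun A => (hcomp A).exists_contribution hfg h hF
  have hblk : ∀ i, ∃ A : (componentPartition g).parts, i ∈ rows A.1 := fun i => by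
    obtain ⟨j, hj⟩ := dep_nonempty (hfg.right i)
    obtain ⟨A, hA, hij⟩ := (componentPartition g).exists_mem (mem_cells.2 hj)
    exact ⟨⟨A, hA⟩, mem_rows.2 ⟨j, hij⟩⟩
  choose blk hblk using hblk
  have hblk_eq : ∀ {i A}, i ∈ rows A.1 → blk i = A := by
    intro i A hi
    by_contra hno
    exact Finset.disjoint_left.1 (isBlockPartition_componentPartition g _ (blk i).2 _ A.2
      fun h => hno (Subtype.ext h)).1 (hblk i) hi
  have ha_congr : ∀ A x y, (∀ i, blk i = A → x i = y i) → a A x = a A y := fun A x y hxy =>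
    eq_of_eqOn_dep _ fun i hi => hxy i (hblk_eq (hdep A hi))
  -- Exchanging the blocks of coordinates one after the other shows that `F` is a function of `a`.
  have hFa : ∀ x y, (∀ A, a A x = a A y) → F x = F y := by
    intro x y hxy
    have key : ∀ S : Finset (componentPartition g).parts,
        F x = F fun i => if blk i ∈ S then y i else x i := by
      intro S
      induction S using Finset.induction_on with
      | empty => simp
      | insert A S hAS ih =>
        rw [ih]
        refine hdet A _ _ (fun i hi => ?_) ?_
        · have : blk i ≠ A := fun h => hi (h ▸ hblk i)
          simp [Finset.mem_insert, this]
        · have h1 : a A (fun i => if blk i ∈ S then y i else x i) = a A x :=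
            ha_congr A _ _ fun i hi => by simp [hi, hAS]
          have h2 : a A (fun i => if blk i ∈ insert A S then y i else x i) = a A y :=
            ha_congr A _ _ fun i hi => by simp [hi]
          rw [h1, h2, hxy]
    simpa using key Finset.univ
  choose s hs using fun A => exists_eq_of_not_isConst (hne A)
  have hglue : ∀ (t : Cube (componentPartition g).parts) A,
      a A (fun i => s (blk i) (t (blk i)) i) = t A := fun t A => by
    rw [ha_congr A _ (s A (t A)) fun i hi => by rw [hi], hs]
  have hFh : ∀ x, F x = F fun i => s (blk i) (a (blk i) x) i := fun x =>
    hFa _ _ fun A => (hglue (fun A => a A x) A).symm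
  refine ⟨fun t => F fun i => s (blk i) (t (blk i)) i, a, b, ?_, hFh, fun y => ?_, hab⟩
  · rw [Finset.eq_univ_iff_forall]
    intro A
    by_contra hA
    obtain ⟨⟨i, j⟩, hij⟩ := (hcomp A).nonempty
    obtain ⟨x, hx⟩ := GeneralizedPolymorphism.mem_dep.1 (hF ▸ Finset.mem_univ i : i ∈ dep F)
    apply hx
    rw [hFh, hFh (update x i (-1))]
    refine eq_of_eqOn_dep (fun t : Cube (componentPartition g).parts =>
      F fun i => s (blk i) (t (blk i)) i) (x := fun A => a A (update x i 1))
      (y := fun A => a A (update x i (-1))) fun B hB => ?_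
    refine ha_congr B _ _ fun k hk => ?_
    have hki : k ≠ i := by
      rintro rfl
      exact hA ((hblk_eq (mem_rows.2 ⟨j, hij⟩)).symm.trans hk ▸ hB)
    simp [hki]
  · obtain ⟨z, rfl⟩ := exists_apply_eq' hfg.left y
    refine (h fun i j => z j i).symm.trans ?_
    rw [hFh]
    congr 1
    funext i
    congr 1
    have hA := hcomp (blk i)
    have hrow : ∀ k l, k ∈ rows (blk i).1 → l ∈ dep (g k) → (k, l) ∈ (blk i).1 :=
      fun k l h1 h2 => hA.mem_of_mem_rows h1 h2
    have hcol : ∀ k l, l ∈ cols (blk i).1 → l ∈ dep (g k) → (k, l) ∈ (blk i).1 :=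
      fun k l h1 h2 => hA.mem_of_mem_cols hfg h1 ((hfg.mem_iff k l).1 h2)
    rcases hab (blk i) with h | h | h
    · exact h.eval fun i j => z j i
    · exact h.eval hfg.mem_iff hrow hcol fun i j => z j i
    · exact h.eval hfg.mem_iff hrow hcol fun i j => z j i

end Partition

/-! ### Reduction to the relevant coordinates -/

section Reduction

variable {ι κ : Type*} [Fintype ι] [DecidableEq ι] [Fintype κ] [DecidableEq κ]

theorem restrict_apply {S : Finset ι} {φ : BoolFun ι} (h : dep φ ⊆ S) (x : Cube ι) :
    restrict S φ (fun i => x i) = φ x := by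
  rw [restrict_eq]
  exact eq_of_eqOn_dep φ fun i hi => extend_of_mem (h hi)

theorem mem_dep_restrict {S : Finset ι} {φ : BoolFun ι} (h : dep φ ⊆ S) (i : S) :
    i ∈ dep (restrict S φ) ↔ i.1 ∈ dep φ := by
  have hupd : ∀ (x : Cube ι) c, restrict S φ (update (fun k : S => x k) i c) =
      φ (update x i.1 c) := fun x c => by
    rw [← restrict_apply h]
    congr 1
    funext k
    by_cases hk : k = i
    · subst hk; simp
    · rw [update_of_ne hk, update_of_ne fun h => hk (Subtype.ext h)]
  rw [mem_dep, mem_dep]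
  constructor
  · rintro ⟨u, hu⟩
    refine ⟨extend S 1 u, ?_⟩
    have : (fun k : S => extend S 1 u k) = u := funext fun k => extend_of_mem k.2
    rwa [← hupd, ← hupd, this]
  · rintro ⟨x, hx⟩
    exact ⟨fun k => x k, by rwa [hupd, hupd]⟩

theorem not_isConst_restrict {S : Finset ι} {φ : BoolFun ι} (h : dep φ ⊆ S) (hne : ¬ IsConst φ) :
    ¬ IsConst (restrict S φ) := by
  obtain ⟨i, hi⟩ := dep_nonempty hne
  exact not_isConst_of_mem_dep ((mem_dep_restrict h ⟨i, h hi⟩).2 hi)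

variable {f₀ : BoolFun ι} {f : κ → BoolFun ι} {g₀ : BoolFun κ} {g : ι → BoolFun κ}

theorem fixConst_apply {x : Cube ι} (h : ∀ i, IsConst (g i) → ∀ y, x i = g i y) :
    fixConst f₀ g x = f₀ x := by
  unfold fixConst
  congr 1
  funext i
  split_ifs with hi
  · exact (h i hi _).symm
  · rfl

theorem IsConst.apply_eq {φ : BoolFun ι} (h : IsConst φ) (x y : Cube ι) : φ x = φ y := by
  obtain ⟨c, hc⟩ := h
  rw [hc, hc]

theorem fixConst_comp (f₀ : BoolFun ι) (g : ι → BoolFun κ) (z : ι → κ → ℤˣ) :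
    fixConst f₀ g (fun i => g i (z i)) = f₀ fun i => g i (z i) :=
  fixConst_apply fun _ hi _ => hi.apply_eq _ _

theorem IsGenPoly.fixConst (h : IsGenPoly f₀ f g₀ g) :
    IsGenPoly (fixConst f₀ g) f (fixConst g₀ f) g := fun z => by
  rw [fixConst_comp, h z]
  exact (fixConst_comp g₀ f fun j i => z i j).symm

theorem not_isConst_of_mem_core {i : ι} (h : i ∈ core f₀ g) : ¬ IsConst (g i) := by
  intro hc
  refine not_mem_dep.2 (fun x c => ?_) h
  unfold GeneralizedPolymorphism.fixConst
  congr 1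
  funext k
  split_ifs with hk
  · rfl
  · rw [update_of_ne (by rintro rfl; exact hk hc)]

theorem IsGenPoly.dep_subset_core (h : IsGenPoly f₀ f g₀ g) {i : ι} (hi : i ∈ core f₀ g) :
    dep (g i) ⊆ core g₀ f :=
  fun _ hj => (h.fixConst.mem_dep (fun _ => not_isConst_of_mem_core) hi hj).1

theorem reduced_comp (hg : ∀ i ∈ core f₀ g, dep (g i) ⊆ core g₀ f) (z : ι → κ → ℤˣ) :
    reduced f₀ g (fun i => subfamily (core g₀ f) (core f₀ g) g i fun j => z i j) =
      f₀ fun i => g i (z i) := by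
  rw [← fixConst_comp f₀ g z, ← restrict_apply (S := core f₀ g) (φ := fixConst f₀ g) subset_rfl]
  exact congrArg _ (funext fun i => restrict_apply (hg i i.2) (z i))

theorem isGenPoly_reduced_iff (hf : ∀ j ∈ core g₀ f, dep (f j) ⊆ core f₀ g)
    (hg : ∀ i ∈ core f₀ g, dep (g i) ⊆ core g₀ f) :
    IsGenPoly (reduced f₀ g) (subfamily (core f₀ g) (core g₀ f) f)
      (reduced g₀ f) (subfamily (core g₀ f) (core f₀ g) g) ↔ IsGenPoly f₀ f g₀ g := by
  constructor
  · intro h z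
    rw [← reduced_comp hg z]
    refine Eq.trans ?_ (reduced_comp hf fun j i => z i j)
    exact h fun i j => z i j
  · intro h z
    -- The values outside of the relevant rows and columns are immaterial.
    let w : ι → κ → ℤˣ := fun i j =>
      if hij : i ∈ core f₀ g ∧ j ∈ core g₀ f then z ⟨i, hij.1⟩ ⟨j, hij.2⟩ else 1
    have hw : z = fun (i : core f₀ g) (j : core g₀ f) => w i j := by
      funext i j
      simp [w]
    rw [hw]
    exact (reduced_comp hg w).trans ((h w).trans (reduced_comp hf fun j i => w i j).symm)

theorem IsGenPoly.isCompatible_subfamily (h : IsGenPoly f₀ f g₀ g) :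
    IsCompatible (subfamily (core f₀ g) (core g₀ f) f) (subfamily (core g₀ f) (core f₀ g) g) where
  left j := not_isConst_restrict (h.symm.dep_subset_core j.2) (not_isConst_of_mem_core j.2)
  right i := not_isConst_restrict (h.dep_subset_core i.2) (not_isConst_of_mem_core i.2)
  mem_iff i j := by
    unfold subfamily
    rw [mem_dep_restrict (h.dep_subset_core i.2), mem_dep_restrict (h.symm.dep_subset_core j.2)]
    exact ⟨fun hj => (h.fixConst.mem_dep (fun _ => not_isConst_of_mem_core) i.2 hj).2,
      fun hi => (h.fixConst.symm.mem_dep (fun _ => not_isConst_of_mem_core) j.2 hi).2⟩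

theorem dep_reduced (f₀ : BoolFun ι) (g : ι → BoolFun κ) : dep (reduced f₀ g) = Finset.univ :=
  Finset.eq_univ_iff_forall.2 fun i => (mem_dep_restrict subset_rfl i).2 i.2

/-- The composition only involves the values of the outer function at points compatible with the
constant inner functions, and the inner functions at relevant coordinates. -/
theorem comp_eq_comp {p₀ : BoolFun ι} {q : ι → BoolFun κ}
    (h₀ : ∀ x : Cube ι, (∀ i, IsConst (g i) → ∀ y, x i = g i y) → p₀ x = f₀ x)
    (h : ∀ i, IsConst (g i) ∨ i ∈ core f₀ g → q i = g i) (z : ι → κ → ℤˣ) :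
    p₀ (fun i => q i (z i)) = f₀ fun i => g i (z i) := by
  have hx : ∀ i, IsConst (g i) → ∀ y, q i (z i) = g i y := fun i hi y => by
    rw [h i (Or.inl hi)]
    exact hi.apply_eq _ _
  rw [h₀ _ hx, ← fixConst_apply (f₀ := f₀) (g := g) hx, ← fixConst_comp f₀ g z]
  exact eq_of_eqOn_dep (fixConst f₀ g) fun i hi => by rw [h i (Or.inr hi)]

end Reduction

end GeneralizedPolymorphism

open GeneralizedPolymorphism
theorem mainTheorem1 (n m : ℕ)
    (f₀ : BoolFun (Fin n)) (f : Fin m → BoolFun (Fin n))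
    (g₀ : BoolFun (Fin m)) (g : Fin n → BoolFun (Fin m)) :
    (IsGenPoly f₀ f g₀ g →
      (∀ j ∈ core g₀ f, dep (f j) ⊆ core f₀ g) ∧ (∀ i ∈ core f₀ g, dep (g i) ⊆ core g₀ f) ∧
      ∃ P : Finpartition (cells (subfamily (core g₀ f) (core f₀ g) g)),
        IsBlockPartition P ∧ HasConnectedBlocks P ∧
        HasBlockForm (reduced f₀ g) (subfamily (core f₀ g) (core g₀ f) f)
          (reduced g₀ f) (subfamily (core g₀ f) (core f₀ g) g) P) ∧
    ((∀ j ∈ core g₀ f, dep (f j) ⊆ core f₀ g) → (∀ i ∈ core f₀ g, dep (g i) ⊆ core g₀ f) →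
      (∃ P : Finpartition (cells (subfamily (core g₀ f) (core f₀ g) g)),
        IsBlockPartition P ∧
        HasBlockForm (reduced f₀ g) (subfamily (core f₀ g) (core g₀ f) f)
          (reduced g₀ f) (subfamily (core g₀ f) (core f₀ g) g) P) →
      IsGenPoly f₀ f g₀ g) ∧
    (∀ (p₀ : BoolFun (Fin n)) (p : Fin m → BoolFun (Fin n))
      (q₀ : BoolFun (Fin m)) (q : Fin n → BoolFun (Fin m)),
      (∀ x : Cube (Fin n), (∀ i, IsConst (g i) → ∀ y, x i = g i y) → p₀ x = f₀ x) →
      (∀ y : Cube (Fin m), (∀ j, IsConst (f j) → ∀ x, y j = f j x) → q₀ y = g₀ y) →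
      (∀ j, IsConst (f j) ∨ j ∈ core g₀ f → p j = f j) →
      (∀ i, IsConst (g i) ∨ i ∈ core f₀ g → q i = g i) →
      (IsGenPoly p₀ p q₀ q ↔ IsGenPoly f₀ f g₀ g)) := by
  refine ⟨fun h => ?_, fun hf hg ⟨P, hP, hblock⟩ => ?_, fun p₀ p q₀ q hp₀ hq₀ hp hq => ?_⟩
  · have hf : ∀ j ∈ core g₀ f, dep (f j) ⊆ core f₀ g := fun j hj => h.symm.dep_subset_core hj
    have hg : ∀ i ∈ core f₀ g, dep (g i) ⊆ core g₀ f := fun i hi => h.dep_subset_core hi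
    exact ⟨hf, hg, componentPartition _, isBlockPartition_componentPartition _,
      fun A hA => (isComponent_of_mem_parts hA).connected,
      ((isGenPoly_reduced_iff hf hg).2 h).hasBlockForm h.isCompatible_subfamily (dep_reduced f₀ g)⟩
  · exact (isGenPoly_reduced_iff hf hg).1 (.of_hasBlockForm hP hblock)
  · exact forall_congr' fun z => by
      rw [comp_eq_comp hp₀ hq z, comp_eq_comp hq₀ hp fun j i => z i j]
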